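/- Let $d\ge 2$, let $\mathcal V=\{v_0=0,v_1,\dots,v_n\}\subset\mathbb R^d$ be distinct velocities and $w=(w_0,\dots,w_n)$ positive weights such that $(\mathcal V,w)$ is an isotropic lattice with speed of sound $c_s>0$, i.e. $\sum_i w_i=1$, $\sum_i w_iv_{i,\alpha}=0$, $\sum_i w_iv_{i,\alpha}v_{i,\beta}=c_s^2\delta_{\alpha\beta}$, $\sum_i w_iv_{i,\alpha}v_{i,\beta}v_{i,\gamma}=0$, $\sum_i w_iv_{i,\alpha}v_{i,\beta}v_{i,\gamma}v_{i,\zeta}=c_s^4(\delta_{\alpha\beta}\delta_{\gamma\zeta}+\delta_{\alpha\gamma}\delta_{\beta\zeta}+\delta_{\alpha\zeta}\delta_{\beta\gamma})$. For $\varepsilon>0$ let $\Lambda_\varepsilon h$ be the inverse Fourier transform of $1_{|\xi|<1/\varepsilon}\,\widehat h(\xi)$, where $\widehat h(\xi)=\int h(x)e^{-2\pi i x\cdot\xi}\,dx$; it acts componentwise on $g=(g_0,\dots,g_n)$. Let $\nu>0$ and $m\in\mathbb N$, $m>d$. Write $\|f\|_{H^m_xL^2_{v,w}}^2=\sum_{i}w_i\sum_{|\tau|\le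 m}\|\partial_x^\tau f_i\|_{L^2(\mathbb R^d)}^2$ for real-valued $f=(f_0,\dots,f_n)$. Consider the approximate LBGK Boltzmann equation $$\varepsilon\,\partial_t\Lambda_\varepsilon(g_i)+v_i\cdot\nabla_x\Lambda_\varepsilon(g_i)=\frac1{\varepsilon\nu}\big(\mathcal G_{i,eq}-\Lambda_\varepsilon(g_i)\big),\qquad \Lambda_\varepsilon(g)|_{t=0}=\Lambda_\varepsilon(g^0),\qquad 0\le i\le n,$$ $$\mathcal G_{i,eq}=\Lambda_\varepsilon(\rho)+\frac{v_i\cdot\Lambda_\varepsilon(u)}{c_s^2}+\frac{\varepsilon}{2c_s^4}\sum_{\alpha,\beta=1}^d(v_{i,\alpha}v_{i,\beta}-c_s^2\delta_{\alpha\beta})\,\Lambda_\varepsilon\big(\Lambda_\varepsilon(u)_\alpha\Lambda_\varepsilon(u)_\beta\big),$$ with $\Lambda_\varepsilon(\rho)=\sum_iw_i\Lambda_\varepsilon(g_i)$, $\Lambda_\varepsilon(u)=\sum_iw_iv_i\Lambda_\varepsilon(g_i)$. There are a constant $c_0=c_0(\mathcal V,c_s,m,d)>0$ and a function $T=T_{\nu,\mathcal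 V,c_s,m,d}:[0,\infty)\to(0,\infty)$, nonincreasing on $(0,\infty)$ and not depending on $\varepsilon$, such that for every $\varepsilon>0$ and every $g^0\in H^m_xL^2_{v,w}$, with $$A:=\|\Lambda_\varepsilon(g^0)\|^2_{H^m_xL^2_{v,w}},\qquad T_0:=T(A),$$ the equation with initial data $\Lambda_\varepsilon(g^0)$ is well-posed on $[0,T_0]$: there is a solution $g\in L^\infty([0,T_0];H^m_xL^2_{v,w})$ with $g=\Lambda_\varepsilon(g)$ and $g|_{t=0}=\Lambda_\varepsilon(g^0)$; $\Lambda_\varepsilon(g)$ is uniquely determined among all solutions in $L^\infty([0,T'];H^m_xL^2_{v,w})$, for every $0<T'\le T_0$; and for initial data close to $\Lambda_\varepsilon(g^0)$ in $H^m_xL^2_{v,w}$ solutions exist on $[0,T_0]$ and stay close, uniformly in $t\in[0,T_0]$, in $H^m_xL^2_{v,w}$. Moreover the solution with $g=\Lambda_\varepsilon(g)$ is differentiable in time with values in $L^2$, $\nu-c_0T_0A>0$, and $$\sup_{t\in[0,T_0]}\|g(t)\|_{H^m_xL^2_{v,w}}^2+\frac1{\varepsilon^2}\int_0^{T_0}\|\mathcal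 G_{eq}(s)-g(s)\|_{H^m_xL^2_{v,w}}^2\,ds\le\frac{(\nu+\nu^2)A}{\nu-c_0T_0A}-\nu A .$$ -/

import Mathlib

open MeasureTheory Set
open scoped FourierTransform LineDeriv SchwartzMap

namespace LBGK

noncomputable section

/-- The space domain `ℝ^d`. -/
abbrev Space (d : ℕ) : Type := EuclideanSpace ℝ (Fin d)

/-- Real-valued square integrable functions on `ℝ^d`. -/
abbrev L2 (d : ℕ) : Type := Lp (α := Space d) ℝ 2

/-- Complex-valued square integrable functions on `ℝ^d`. -/
abbrev L2C (d : ℕ) : Type := Lp (α := Space d) ℂ 2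

/-- Vectors `(f_0, …, f_n)` of real-valued square integrable functions on `ℝ^d`. -/
abbrev State (d n : ℕ) : Type := Fin (n + 1) → L2 d

/-- A real-valued `L²` function viewed as a complex-valued one. -/
def toComplex {d : ℕ} (f : L2 d) : L2C d := Complex.ofRealCLM.compLp f

/-- The real part of a complex-valued `L²` function. -/
def realPart {d : ℕ} (f : L2C d) : L2 d := Complex.reCLM.compLp f

/-! ### Isotropic lattices -/

/-- `({v_0 = 0, v_1, …, v_n}, w)` is a lattice (distinct velocities, positive weights) that is
isotropic with speed of sound `cs > 0`. -/
structure IsIsotropicLattice {d n : ℕ} (v : Fin (n + 1) → Space d) (w : Fin (n + 1) → ℝ)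
    (cs : ℝ) : Prop where
  v_zero : v 0 = 0
  v_injective : Function.Injective v
  w_pos : ∀ i, 0 < w i
  cs_pos : 0 < cs
  moment_zero : ∑ i, w i = 1
  moment_one : ∀ a, ∑ i, w i * v i a = 0
  moment_two : ∀ a b, ∑ i, w i * v i a * v i b = cs ^ 2 * (if a = b then 1 else 0)
  moment_three : ∀ a b c, ∑ i, w i * v i a * v i b * v i c = 0
  moment_four : ∀ a b c e, ∑ i, w i * v i a * v i b * v i c * v i e =
    cs ^ 4 * ((if a = b then 1 else 0) * (if c = e then 1 else 0)
      + (if a = c then 1 else 0) * (if b = e then 1 else 0)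
      + (if a = e then 1 else 0) * (if b = c then 1 else 0))

/-! ### Weak derivatives and Sobolev spaces -/

/-- `∂^τ = ∂_1^{τ_1} ⋯ ∂_d^{τ_d}` on tempered distributions. -/
def distribDeriv {d : ℕ} (τ : Fin d → ℕ) (S : 𝓢'(Space d, ℂ)) : 𝓢'(Space d, ℂ) :=
  (List.finRange d).foldr
    (fun j R => (fun Q : 𝓢'(Space d, ℂ) => ∂_{EuclideanSpace.single j (1 : ℝ)} Q)^[τ j] R) S

/-- `g ∈ L²` is the distributional derivative `∂^τ f` of `f ∈ L²`. -/
def IsWeakDeriv {d : ℕ} (τ : Fin d → ℕ) (f g : L2 d) : Prop :=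
  distribDeriv τ (toComplex f : 𝓢'(Space d, ℂ)) = (toComplex g : 𝓢'(Space d, ℂ))

theorem toComplex_injective {d : ℕ} : Function.Injective (toComplex (d := d)) := by
  intro f g h
  have hf := Complex.ofRealCLM.coeFn_compLp f
  have hg := Complex.ofRealCLM.coeFn_compLp g
  have h' : Complex.ofRealCLM.compLp f = Complex.ofRealCLM.compLp g := h
  rw [h'] at hf
  apply Lp.ext
  filter_upwards [hf, hg] with x h1 h2
  rw [h1] at h2
  exact Complex.ofReal_injective (by simpa using h2)

/-- A function has at most one weak derivative of a given order. -/
theorem IsWeakDeriv.unique {d : ℕ} {τ : Fin d → ℕ} {f g h : L2 d}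
    (hg : IsWeakDeriv τ f g) (hh : IsWeakDeriv τ f h) : g = h := by
  apply toComplex_injective
  have h1 : Lp.toTemperedDistributionCLM ℂ (volume : Measure (Space d)) 2 (toComplex g)
      = Lp.toTemperedDistributionCLM ℂ (volume : Measure (Space d)) 2 (toComplex h) := by
    simpa using (hg.symm.trans hh)
  have hk := Lp.ker_toTemperedDistributionCLM_eq_bot (F := ℂ)
    (μ := (volume : Measure (Space d))) (p := 2)
  exact LinearMap.ker_eq_bot.mp hk h1

open Classical in
/-- The weak derivative `∂^τ f ∈ L²`, if it exists (and `0` otherwise). -/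
def weakDeriv {d : ℕ} (τ : Fin d → ℕ) (f : L2 d) : L2 d :=
  if h : ∃ g, IsWeakDeriv τ f g then h.choose else 0

theorem IsWeakDeriv.weakDeriv_eq {d : ℕ} {τ : Fin d → ℕ} {f g : L2 d}
    (hg : IsWeakDeriv τ f g) : weakDeriv τ f = g := by
  have h : ∃ g, IsWeakDeriv τ f g := ⟨g, hg⟩
  rw [weakDeriv, dif_pos h]
  exact h.choose_spec.unique hg

/-- `f ∈ H^m(ℝ^d)`: all weak derivatives of order at most `m` exist in `L²`. -/
def MemH {d : ℕ} (m : ℕ) (f : L2 d) : Prop :=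
  ∀ τ : Fin d → ℕ, ∑ j, τ j ≤ m → ∃ g, IsWeakDeriv τ f g

/-- `‖f‖²_{H^m} = ∑_{|τ| ≤ m} ‖∂^τ f‖²_{L²}`. -/
def sobolevNormSq {d : ℕ} (m : ℕ) (f : L2 d) : ℝ :=
  ∑ k ∈ Finset.range (m + 1), ∑ τ ∈ Finset.piAntidiag (Finset.univ : Finset (Fin d)) k,
    ‖weakDeriv τ f‖ ^ 2

/-- Membership in `H^m_x L²_{v,w}`: every component is in `H^m`. -/
def StateMemH {d n : ℕ} (m : ℕ) (g : State d n) : Prop := ∀ i, MemH m (g i)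

/-- `‖g‖²_{H^m_x L²_{v,w}} = ∑_i w_i ‖g_i‖²_{H^m}`. -/
def stateNormSq {d n : ℕ} (m : ℕ) (w : Fin (n + 1) → ℝ) (g : State d n) : ℝ :=
  ∑ i, w i * sobolevNormSq m (g i)

/-! ### The Fourier cutoff -/

/-- Multiplication of an `L²` function by the indicator of the open ball of radius `1 / ε`. -/
def truncate {d : ℕ} (ε : ℝ) (F : L2C d) : L2C d :=
  MemLp.toLp ((Metric.ball (0 : Space d) (1 / ε)).indicator F)
    ((Lp.memLp F).indicator Metric.isOpen_ball.measurableSet)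

/-- `Λ_ε h`: the inverse Fourier transform of `1_{|ξ| < 1/ε} ĥ(ξ)`, with the `L²` Fourier transform
`ĥ(ξ) = ∫ h(x) e^{-2πi x·ξ} dx`. As `h` is real-valued and the ball is symmetric, this inverse
transform is real-valued, and `realPart` only changes its codomain. -/
def cutoff {d : ℕ} (ε : ℝ) (h : L2 d) : L2 d :=
  realPart (𝓕⁻ (truncate ε (𝓕 (toComplex h))))

/-- `Λ_ε` applied to every component. -/
def stateCutoff {d n : ℕ} (ε : ℝ) (g : State d n) : State d n := fun i => cutoff ε (g i)

/-! ### The approximate LBGK Boltzmann equation -/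

open Classical in
/-- The pointwise product of two functions, if it is square integrable (and `0` otherwise). It is
used only for functions in the range of the cutoff: these are bounded, and so their product is
square integrable. -/
def mulL2 {d : ℕ} (f g : L2 d) : L2 d :=
  if h : MemLp (fun x => f x * g x) 2 (volume : Measure (Space d)) then h.toLp else 0

/-- `Λ_ε(ρ) = ∑_i w_i Λ_ε(g_i)`. -/
def cutoffDensity {d n : ℕ} (ε : ℝ) (w : Fin (n + 1) → ℝ) (g : State d n) : L2 d :=
  ∑ i, w i • cutoff ε (g i)

/-- The `a`-th component of `Λ_ε(u) = ∑_i w_i v_i Λ_ε(g_i)`. -/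
def cutoffVelocity {d n : ℕ} (ε : ℝ) (v : Fin (n + 1) → Space d) (w : Fin (n + 1) → ℝ)
    (g : State d n) (a : Fin d) : L2 d :=
  ∑ i, (w i * v i a) • cutoff ε (g i)

/-- The equilibrium `𝒢_eq` of the approximate equation:
`𝒢_{i,eq} = Λ_ε(ρ) + v_i·Λ_ε(u) / cs²
  + ε / (2 cs⁴) ∑_{a,b} (v_{i,a} v_{i,b} - cs² δ_{ab}) Λ_ε(Λ_ε(u)_a Λ_ε(u)_b)`. -/
def equilibrium {d n : ℕ} (ε : ℝ) (v : Fin (n + 1) → Space d) (w : Fin (n + 1) → ℝ) (cs : ℝ)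
    (g : State d n) : State d n := fun i =>
  cutoffDensity ε w g
    + (1 / cs ^ 2) • ∑ a, v i a • cutoffVelocity ε v w g a
    + (ε / (2 * cs ^ 4)) • ∑ a, ∑ b, (v i a * v i b - cs ^ 2 * (if a = b then 1 else 0)) •
        cutoff ε (mulL2 (cutoffVelocity ε v w g a) (cutoffVelocity ε v w g b))

/-- `v_i · ∇_x f_i` for every `i`, with weak derivatives. -/
def transport {d n : ℕ} (v : Fin (n + 1) → Space d) (f : State d n) : State d n := fun i =>
  ∑ a, v i a • weakDeriv (Pi.single a 1) (f i)

/-- The value that the approximate equation prescribes for `ε ∂_t Λ_ε(g)`, namely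
`(1 / (ε ν)) (𝒢_eq - Λ_ε(g)) - v·∇_x Λ_ε(g)`. -/
def rhs {d n : ℕ} (ε ν : ℝ) (v : Fin (n + 1) → Space d) (w : Fin (n + 1) → ℝ) (cs : ℝ)
    (g : State d n) : State d n :=
  (1 / (ε * ν)) • (equilibrium ε v w cs g - stateCutoff ε g) - transport v (stateCutoff ε g)

/-- `g ∈ L^∞([0,T]; H^m_x L²_{v,w})` solves on `[0,T]` the approximate LBGK Boltzmann equation with
initial value `Λ_ε(g)|_{t=0} = Λ_ε(g0)`, in the time-integrated form. -/
structure IsSolution {d n : ℕ} (m : ℕ) (ε ν : ℝ) (v : Fin (n + 1) → Space d)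
    (w : Fin (n + 1) → ℝ) (cs T : ℝ) (g0 : State d n) (g : ℝ → State d n) : Prop where
  memH : ∀ t ∈ Icc 0 T, StateMemH m (g t)
  bounded : ∃ M : ℝ, ∀ t ∈ Icc 0 T, stateNormSq m w (g t) ≤ M
  measurable : AEStronglyMeasurable g (volume.restrict (Icc 0 T))
  integrable : IntervalIntegrable (fun s => rhs ε ν v w cs (g s)) volume 0 T
  equation : ∀ t ∈ Icc 0 T, ε • stateCutoff ε (g t) =
    ε • stateCutoff ε g0 + ∫ s in (0 : ℝ)..t, rhs ε ν v w cs (g s)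

/-- A solution that satisfies `g = Λ_ε(g)` on `[0,T]`. -/
def IsBandLimitedSolution {d n : ℕ} (m : ℕ) (ε ν : ℝ) (v : Fin (n + 1) → Space d)
    (w : Fin (n + 1) → ℝ) (cs T : ℝ) (g0 : State d n) (g : ℝ → State d n) : Prop :=
  IsSolution m ε ν v w cs T g0 g ∧ ∀ t ∈ Icc 0 T, g t = stateCutoff ε (g t)

/-- Well-posedness on `[0,T]`, in the sense of Hadamard, of the approximate equation at the initial
data `Λ_ε(g0)`. Since the equation only involves `Λ_ε(g)`, uniqueness concerns `Λ_ε(g)`; for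
band-limited solutions this is `g` itself. -/
structure IsWellPosed {d n : ℕ} (m : ℕ) (ε ν : ℝ) (v : Fin (n + 1) → Space d)
    (w : Fin (n + 1) → ℝ) (cs T : ℝ) (g0 : State d n) : Prop where
  exists_solution : ∃ g, IsBandLimitedSolution m ε ν v w cs T g0 g
  unique : ∀ T' : ℝ, 0 < T' → T' ≤ T → ∀ g h : ℝ → State d n,
    IsSolution m ε ν v w cs T' g0 g → IsSolution m ε ν v w cs T' g0 h →
      ∀ t ∈ Icc 0 T', stateCutoff ε (g t) = stateCutoff ε (h t)
  continuous_dependence : ∀ δ : ℝ, 0 < δ → ∃ η : ℝ, 0 < η ∧ ∀ h0 : State d n, StateMemH m h0 →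
    stateNormSq m w (stateCutoff ε h0 - stateCutoff ε g0) < η →
      (∃ h, IsBandLimitedSolution m ε ν v w cs T h0 h) ∧
      ∀ g h : ℝ → State d n,
        IsSolution m ε ν v w cs T g0 g → IsSolution m ε ν v w cs T h0 h →
          ∀ t ∈ Icc 0 T, stateNormSq m w (stateCutoff ε (h t) - stateCutoff ε (g t)) < δ

end

end LBGK

/-!
The Fourier cutoff turns the equation into an ordinary differential equation. On the range of `Λ_ε`
every derivative `∂^τ` is a bounded operator of `L²` (`truncDeriv`), the products
`Λ_ε(Λ_ε f · Λ_ε g)` form a bounded bilinear map of `L²` (`exists_bilinear_cutoff_mulL2`), and the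
norms of `H^m` and `L²` are equivalent. So the equation is `x' = field x` for a vector field on
`L²(ℝ^d)^{n+1}` that is Lipschitz on balls (`lipschitzOnBalls_field`), and a solution in the integrated
sense is the same as an integral curve. Uniqueness and continuous dependence are Grönwall's
inequality; existence up to a given time only needs an a priori bound
(`exists_isIntegralCurveOn_of_apriori_bound`). The operator norms and Lipschitz constants depend on
`ε`, but the time of existence must not, and so the a priori bound has to come from an energy
inequality that is uniform in `ε`.

For the energy inequality, let `h_i = 𝒢_{i,eq} - g_i`. By isotropy, `h` has vanishing mass and momentum
(`IsIsotropicLattice.sum_collision`, `IsIsotropicLattice.sum_velocity_collision`), so it is orthogonal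
to the linear part of the equilibrium. With `Q` for the quadratic part this gives
`2 ∑ w_i ⟨g_i, h_i⟩ = 2 ∑ w_i ⟨Q_i - h_i, h_i⟩ ≤ ∑ w_i ‖Q_i‖² - ∑ w_i ‖h_i‖²`
(`IsIsotropicLattice.sum_inner_collision_le`), in `H^m` as well as in `L²`, since all operators in
sight commute with derivatives. Transport is skew-symmetric and drops out. The factor `ε` in `Q` and
the algebra property of `H^m` (`exists_bandNormSq_mulL2_le`, whose constant does not see the cutoff)
bound the first term by `ε² K Y²`, where `Y = ‖g‖²_{H^m}`. Dividing by `ε² ν`,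
`Y' + ‖h‖² / (ε² ν) ≤ (K / ν) Y²`.

A comparison with an affine barrier (`le_of_deriv_right_le_mul_sq`) keeps
`Y(t) + (ε² ν)⁻¹ ∫₀ᵗ ‖h‖²` below `3 A / 2` as long as `9 K A t < 2 ν`. With `c₀ = 4 (K + 1)` and
`T(A) = 2 ν / (3 c₀ A)` this holds up to `T(A)`, where `c₀ T(A) A = 2 ν / 3`; the right-hand side of the
asserted inequality is then `(3 + 2 ν) A`, and the left-hand side is at most `(1 + ν) 3 A / 2`. For
`A = 0` the solution vanishes and any time will do. The weights enter `K` only through `w_i ≤ 1`.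
-/

namespace LBGK

/-! ### The Fourier transform of integrable and of real-valued square integrable functions -/

/-- Locally integrable functions that agree as tempered distributions agree almost everywhere. -/
theorem ae_eq_of_integral_schwartz_smul_eq {d : ℕ} {f g : Space d → ℂ}
    (hf : LocallyIntegrable f) (hg : LocallyIntegrable g)
    (h : ∀ u : 𝓢(Space d, ℂ), ∫ x, u x • f x = ∫ x, u x • g x) : f =ᵐ[volume] g := by
  refine ae_eq_of_integral_contDiff_smul_eq hf hg fun u u_smooth u_cpt => ?_
  have hu₁ : HasCompactSupport (Complex.ofRealCLM ∘ u) := u_cpt.comp_left rfl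
  have hu₂ : ContDiff ℝ (⊤ : ℕ∞) (Complex.ofRealCLM ∘ u) := by fun_prop
  simpa using h (hu₁.toSchwartzMap hu₂)

/-- For integrable functions the `L²` Fourier transform is given by the Fourier integral. -/
theorem fourier_toLp_ae_eq {d : ℕ} {φ : Space d → ℂ} (h₁ : Integrable φ) (h₂ : MemLp φ 2) :
    (𝓕 (h₂.toLp φ) : L2C d) =ᵐ[volume] (𝓕 φ : Space d → ℂ) := by
  refine ae_eq_of_integral_schwartz_smul_eq
    ((Lp.memLp _).locallyIntegrable (by norm_num)) ?_ fun u => ?_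
  · exact (VectorFourier.fourierIntegral_continuous Real.continuous_fourierChar
      (L := innerₗ (Space d)) continuous_inner h₁).locallyIntegrable
  · have e := congrArg (fun S : 𝓢'(Space d, ℂ) => S u)
      (Lp.fourier_toTemperedDistribution_eq (h₂.toLp φ))
    simp only [TemperedDistribution.fourier_apply, Lp.toTemperedDistribution_apply] at e
    rw [← e]
    have e2 : ∫ x, (𝓕 u) x • (h₂.toLp φ : L2C d) x = ∫ x, (𝓕 u) x • φ x := by
      refine integral_congr_ae ?_
      filter_upwards [h₂.coeFn_toLp] with x hx
      rw [hx]
    rw [e2]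
    simpa using! VectorFourier.integral_fourierIntegral_smul_eq_flip (L := innerₗ (Space d))
      Real.continuous_fourierChar continuous_inner u.integrable h₁

theorem fourierInv_toLp_ae_eq {d : ℕ} {φ : Space d → ℂ} (h₁ : Integrable φ) (h₂ : MemLp φ 2) :
    (𝓕⁻ (h₂.toLp φ) : L2C d) =ᵐ[volume] (𝓕⁻ φ : Space d → ℂ) := by
  have h₃ : MemLp (fun x => φ (-x)) 2 := h₂.comp_measurePreserving (Measure.measurePreserving_neg _)
  refine ae_eq_of_integral_schwartz_smul_eq
    ((Lp.memLp _).locallyIntegrable (by norm_num)) ?_ fun u => ?_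
  · rw [Real.fourierInv_eq_fourier_comp_neg]
    exact (VectorFourier.fourierIntegral_continuous Real.continuous_fourierChar
      (L := innerₗ (Space d)) continuous_inner h₁.comp_neg).locallyIntegrable
  · have e := congrArg (fun S : 𝓢'(Space d, ℂ) => S u)
      (Lp.fourierInv_toTemperedDistribution_eq (h₂.toLp φ))
    simp only [TemperedDistribution.fourierInv_apply, Lp.toTemperedDistribution_apply] at e
    rw [← e]
    have e2 : ∫ x, (𝓕⁻ u) x • (h₂.toLp φ : L2C d) x = ∫ x, (𝓕⁻ u) x • φ x := by
      refine integral_congr_ae ?_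
      filter_upwards [h₂.coeFn_toLp] with x hx
      rw [hx]
    rw [e2, ← integral_neg_eq_self, Real.fourierInv_eq_fourier_comp_neg]
    have := VectorFourier.integral_fourierIntegral_smul_eq_flip (L := innerₗ (Space d))
      (μ := volume) (ν := volume)
      Real.continuous_fourierChar continuous_inner u.integrable h₁.comp_neg
    simp only [SchwartzMap.fourierInv_coe, Real.fourierInv_eq_fourier_neg, neg_neg]
    simpa using! this

/-- Complex conjugation on `L²`. -/
noncomputable def conjL2 {d : ℕ} (f : L2C d) : L2C d :=
  (Complex.conjCLE : ℂ →L[ℝ] ℂ).compLp f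

/-- The reflection `x ↦ -x` on `L²`. -/
noncomputable def reflL2 {d : ℕ} (f : L2C d) : L2C d :=
  Lp.compMeasurePreserving Neg.neg (Measure.measurePreserving_neg (volume : Measure (Space d))) f

theorem conjL2_ae {d : ℕ} (f : L2C d) :
    conjL2 f =ᵐ[volume] fun x => (starRingEnd ℂ) (f x) :=
  (Complex.conjCLE : ℂ →L[ℝ] ℂ).coeFn_compLp f

theorem reflL2_ae {d : ℕ} (f : L2C d) : reflL2 f =ᵐ[volume] fun x => f (-x) :=
  Lp.coeFn_compMeasurePreserving f (Measure.measurePreserving_neg (volume : Measure (Space d)))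

/-- The Fourier transform of `conj f` is `ξ ↦ conj (𝓕 f (-ξ))`. -/
theorem fourier_conjL2 {d : ℕ} (f : L2C d) : 𝓕 (conjL2 f) = conjL2 (reflL2 (𝓕 f)) := by
  have hc : Continuous (conjL2 (d := d)) :=
    ((Complex.conjCLE : ℂ →L[ℝ] ℂ).compLpL 2 (volume : Measure (Space d))).continuous
  have hr : Continuous (reflL2 (d := d)) :=
    (Lp.isometry_compMeasurePreserving
      (Measure.measurePreserving_neg (volume : Measure (Space d)))).continuous
  have hF : Continuous (fun f : L2C d => 𝓕 f) := (Lp.fourierTransformₗᵢ (Space d) ℂ).continuous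
  refine DenseRange.induction_on (p := fun f : L2C d => 𝓕 (conjL2 f) = conjL2 (reflL2 (𝓕 f)))
    (SchwartzMap.denseRange_toLpCLM (p := 2) ENNReal.ofNat_ne_top) f
    (isClosed_eq (hF.comp hc) (hc.comp (hr.comp hF))) fun u => ?_
  have hu : SchwartzMap.toLpCLM ℝ (E := Space d) ℂ 2 volume u = u.toLp 2 := rfl
  have i₁ : Integrable (fun x => (starRingEnd ℂ) (u x)) :=
    (Complex.conjCLE : ℂ →L[ℝ] ℂ).integrable_comp u.integrable
  have i₂ : MemLp (fun x => (starRingEnd ℂ) (u x)) 2 :=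
    (Complex.conjCLE : ℂ →L[ℝ] ℂ).comp_memLp' (u.memLp 2 volume)
  have e₁ : conjL2 (u.toLp 2 : L2C d) = i₂.toLp _ := by
    apply Lp.ext
    filter_upwards [conjL2_ae (u.toLp 2 : L2C d), i₂.coeFn_toLp, u.coeFn_toLp 2 volume]
      with x h1 h2 h3
    rw [h1, h2, h3]
  rw [hu, SchwartzMap.toLp_fourier_eq, e₁]
  apply Lp.ext
  have h5 := (Measure.measurePreserving_neg (volume : Measure (Space d))).quasiMeasurePreserving.ae
    ((𝓕 u).coeFn_toLp 2 volume)
  filter_upwards [fourier_toLp_ae_eq i₁ i₂, conjL2_ae (reflL2 ((𝓕 u).toLp 2 : L2C d)),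
    reflL2_ae ((𝓕 u).toLp 2 : L2C d), h5] with x h1 h2 h3 h4
  rw [h1, h2, h3, h4, SchwartzMap.fourier_coe, Real.fourier_eq', Real.fourier_eq', ← integral_conj]
  congr 1
  ext y
  simp [← Complex.exp_conj, Complex.conj_ofNat]

theorem toComplex_ae {d : ℕ} (f : L2 d) : toComplex f =ᵐ[volume] fun x => (f x : ℂ) :=
  Complex.ofRealCLM.coeFn_compLp f

theorem realPart_ae {d : ℕ} (f : L2C d) : realPart f =ᵐ[volume] fun x => (f x).re :=
  Complex.reCLM.coeFn_compLp f

theorem toComplex_realPart {d : ℕ} {f : L2C d} (h : conjL2 f = f) : toComplex (realPart f) = f := by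
  apply Lp.ext
  have h2 := conjL2_ae f
  rw [h] at h2
  filter_upwards [toComplex_ae (realPart f), realPart_ae f, h2] with x h1 h2 h3
  rw [h1, h2]
  exact Complex.conj_eq_iff_re.mp h3.symm

theorem conjL2_toComplex {d : ℕ} (f : L2 d) : conjL2 (toComplex f) = toComplex f := by
  apply Lp.ext
  filter_upwards [toComplex_ae f, conjL2_ae (toComplex f)] with x h1 h2
  rw [h2, h1, Complex.conj_ofReal]

theorem realPart_toComplex {d : ℕ} (f : L2 d) : realPart (toComplex f) = f := by
  apply Lp.ext
  filter_upwards [toComplex_ae f, realPart_ae (toComplex f)] with x h1 h2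
  rw [h2, h1, Complex.ofReal_re]

/-- The `L²` Fourier transform of a real-valued function. -/
noncomputable def hat {d : ℕ} (f : L2 d) : L2C d := 𝓕 (toComplex f)

theorem hat_neg_ae {d : ℕ} (f : L2 d) :
    ∀ᵐ ξ, hat f (-ξ) = (starRingEnd ℂ) (hat f ξ) := by
  have h := fourier_conjL2 (toComplex f)
  rw [conjL2_toComplex] at h
  have h2 := conjL2_ae (reflL2 (𝓕 (toComplex f)))
  rw [← h] at h2
  filter_upwards [h2, reflL2_ae (𝓕 (toComplex f))] with ξ h1 h3
  rw [hat, h1, h3, Complex.conj_conj]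

/-- A square integrable `φ` with `φ(-ξ) = conj φ(ξ)` is the Fourier transform of a real function. -/
theorem hat_realPart_fourierInv {d : ℕ} {φ : L2C d}
    (h : ∀ᵐ ξ, φ (-ξ) = (starRingEnd ℂ) (φ ξ)) : hat (realPart (𝓕⁻ φ)) = φ := by
  have hφ : conjL2 (reflL2 φ) = φ := by
    apply Lp.ext
    filter_upwards [conjL2_ae (reflL2 φ), reflL2_ae φ, h] with ξ h1 h2 h3
    rw [h1, h2, h3, Complex.conj_conj]
  have h1 : conjL2 (𝓕⁻ φ : L2C d) = 𝓕⁻ φ := by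
    refine (Lp.fourierTransformₗᵢ (Space d) ℂ).injective ((fourier_conjL2 (𝓕⁻ φ)).trans ?_)
    have e : 𝓕 (𝓕⁻ φ : L2C d) = φ := FourierTransform.fourier_fourierInv_eq φ
    rw [e, hφ]
    exact e.symm
  rw [hat, toComplex_realPart h1, FourierTransform.fourier_fourierInv_eq]

theorem realPart_fourierInv_hat {d : ℕ} (f : L2 d) : realPart (𝓕⁻ (hat f)) = f := by
  rw [hat, FourierTransform.fourierInv_fourier_eq, realPart_toComplex]

theorem hat_injective {d : ℕ} : Function.Injective (hat (d := d)) :=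
  Function.LeftInverse.injective (g := fun φ => realPart (𝓕⁻ φ)) realPart_fourierInv_hat

theorem toComplex_add {d : ℕ} (f g : L2 d) : toComplex (f + g) = toComplex f + toComplex g :=
  (Complex.ofRealCLM.compLpL 2 (volume : Measure (Space d))).map_add f g

theorem toComplex_smul {d : ℕ} (c : ℝ) (f : L2 d) :
    toComplex (c • f) = (c : ℂ) • toComplex f :=
  ((Complex.ofRealCLM.compLpL 2 (volume : Measure (Space d))).map_smul c f).trans
    (by ext1; simp; rfl)

theorem hat_add {d : ℕ} (f g : L2 d) : hat (f + g) = hat f + hat g := by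
  rw [hat, toComplex_add, FourierTransform.fourier_add]; rfl

theorem hat_smul {d : ℕ} (c : ℝ) (f : L2 d) : hat (c • f) = (c : ℂ) • hat f := by
  rw [hat, toComplex_smul, FourierTransform.fourier_smul]; rfl

/-- Plancherel's identity for real-valued functions. -/
theorem inner_hat {d : ℕ} (f g : L2 d) : inner ℝ f g = (inner ℂ (hat f) (hat g)).re := by
  rw [hat, hat, Lp.inner_fourier_eq, L2.inner_def, L2.inner_def]
  have h : ∫ x, inner ℂ (toComplex f x) (toComplex g x) = ∫ x, ((inner ℝ (f x) (g x) : ℝ) : ℂ) := by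
    refine integral_congr_ae ?_
    filter_upwards [toComplex_ae f, toComplex_ae g] with x h1 h2
    rw [h1, h2]
    simp
  rw [h, integral_complex_ofReal, Complex.ofReal_re]

theorem norm_hat {d : ℕ} (f : L2 d) : ‖hat f‖ = ‖f‖ := by
  have h := inner_hat f f
  rw [real_inner_self_eq_norm_sq, inner_self_eq_norm_sq_to_K] at h
  rw [← sq_eq_sq₀ (norm_nonneg _) (norm_nonneg _), h]
  norm_cast

/-! ### Derivatives of band-limited functions -/

/-- The Fourier symbol `1_{|ξ| < 1/ε} ∏_j (2πi ξ_j)^{τ_j}` of `∂^τ Λ_ε`. -/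
noncomputable def symbol {d : ℕ} (ε : ℝ) (τ : Fin d → ℕ) : Space d → ℂ :=
  (Metric.ball (0 : Space d) (1 / ε)).indicator
    fun ξ => ∏ j, (2 * Real.pi * Complex.I * (ξ j : ℂ)) ^ τ j

theorem symbol_of_mem {d : ℕ} {ε : ℝ} (τ : Fin d → ℕ) {ξ : Space d}
    (h : ξ ∈ Metric.ball (0 : Space d) (1 / ε)) :
    symbol ε τ ξ = ∏ j, (2 * Real.pi * Complex.I * (ξ j : ℂ)) ^ τ j :=
  indicator_of_mem h _

theorem symbol_of_notMem {d : ℕ} {ε : ℝ} (τ : Fin d → ℕ) {ξ : Space d}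
    (h : ξ ∉ Metric.ball (0 : Space d) (1 / ε)) : symbol ε τ ξ = 0 :=
  indicator_of_notMem h _

theorem measurable_symbol {d : ℕ} (ε : ℝ) (τ : Fin d → ℕ) : Measurable (symbol ε τ) := by
  refine Measurable.indicator ?_ Metric.isOpen_ball.measurableSet
  exact Continuous.measurable (by fun_prop)

theorem norm_symbol_le {d : ℕ} (ε : ℝ) (τ : Fin d → ℕ) (ξ : Space d) :
    ‖symbol ε τ ξ‖ ≤ ∏ j, (2 * Real.pi * |1 / ε|) ^ τ j := by
  by_cases h : ξ ∈ Metric.ball (0 : Space d) (1 / ε)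
  · rw [symbol_of_mem τ h, norm_prod]
    refine Finset.prod_le_prod (fun _ _ => norm_nonneg _) fun j _ => ?_
    rw [norm_pow]
    refine pow_le_pow_left₀ (norm_nonneg _) ?_ _
    rw [norm_mul, norm_mul, norm_mul]
    have h1 : ‖ξ j‖ ≤ ‖ξ‖ := PiLp.norm_apply_le ξ j
    have h2 : ‖ξ‖ < 1 / ε := by simpa using h
    have h3 := le_abs_self (1 / ε)
    simp only [Complex.norm_ofNat, Complex.norm_real, Complex.norm_I, mul_one, Real.norm_eq_abs,
      abs_of_pos Real.pi_pos] at h1 ⊢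
    exact mul_le_mul_of_nonneg_left (by linarith) (by positivity)
  · rw [symbol_of_notMem τ h, norm_zero]
    positivity

theorem symbol_neg {d : ℕ} (ε : ℝ) (τ : Fin d → ℕ) (ξ : Space d) :
    symbol ε τ (-ξ) = (starRingEnd ℂ) (symbol ε τ ξ) := by
  have hiff : -ξ ∈ Metric.ball (0 : Space d) (1 / ε) ↔ ξ ∈ Metric.ball (0 : Space d) (1 / ε) := by
    rw [mem_ball_zero_iff, mem_ball_zero_iff, norm_neg]
  by_cases h : ξ ∈ Metric.ball (0 : Space d) (1 / ε)
  · rw [symbol_of_mem τ h, symbol_of_mem τ (hiff.2 h), map_prod]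
    simp [Complex.conj_ofNat]
  · rw [symbol_of_notMem τ h, symbol_of_notMem τ (fun h' => h (hiff.1 h')), map_zero]

theorem symbol_mul_symbol {d : ℕ} (ε : ℝ) (τ σ : Fin d → ℕ) (ξ : Space d) :
    symbol ε τ ξ * symbol ε σ ξ = symbol ε (τ + σ) ξ := by
  by_cases h : ξ ∈ Metric.ball (0 : Space d) (1 / ε)
  · simp only [symbol_of_mem _ h, ← Finset.prod_mul_distrib, Pi.add_apply, pow_add]
  · simp only [symbol_of_notMem _ h, mul_zero]

theorem memLp_symbol_mul {d : ℕ} (ε : ℝ) (τ : Fin d → ℕ) (φ : L2C d) :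
    MemLp (fun ξ => symbol ε τ ξ * φ ξ) 2 :=
  (Lp.memLp φ).of_le_mul
    ((measurable_symbol ε τ).aestronglyMeasurable.mul (Lp.memLp φ).aestronglyMeasurable)
    (Filter.Eventually.of_forall fun ξ => by
      rw [norm_mul]
      exact mul_le_mul_of_nonneg_right (norm_symbol_le ε τ ξ) (norm_nonneg _))

/-- The map `∂^τ Λ_ε` as a Fourier multiplier. The symbol is Hermitian, so the inverse transform is
real-valued, and `realPart` only changes its codomain. -/
noncomputable def truncDerivFun {d : ℕ} (ε : ℝ) (τ : Fin d → ℕ) (f : L2 d) : L2 d :=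
  realPart (𝓕⁻ ((memLp_symbol_mul ε τ (hat f)).toLp _))

theorem hat_truncDerivFun {d : ℕ} (ε : ℝ) (τ : Fin d → ℕ) (f : L2 d) :
    hat (truncDerivFun ε τ f) = (memLp_symbol_mul ε τ (hat f)).toLp _ := by
  have h1 := (memLp_symbol_mul ε τ (hat f)).coeFn_toLp
  have h2 := (Measure.measurePreserving_neg (volume : Measure (Space d))).quasiMeasurePreserving.ae
    h1
  refine hat_realPart_fourierInv ?_
  filter_upwards [h1, h2, hat_neg_ae f] with ξ h3 h4 h5
  rw [h3, h4, h5, symbol_neg, map_mul]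

theorem hat_truncDerivFun_ae {d : ℕ} (ε : ℝ) (τ : Fin d → ℕ) (f : L2 d) :
    hat (truncDerivFun ε τ f) =ᵐ[volume] fun ξ => symbol ε τ ξ * hat f ξ := by
  rw [hat_truncDerivFun]
  exact (memLp_symbol_mul ε τ (hat f)).coeFn_toLp

/-- The bounded operator `∂^τ Λ_ε` on real-valued square integrable functions. -/
noncomputable def truncDeriv {d : ℕ} (ε : ℝ) (τ : Fin d → ℕ) : L2 d →L[ℝ] L2 d :=
  LinearMap.mkContinuous
    { toFun := truncDerivFun ε τ
      map_add' := fun f g => by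
        apply hat_injective
        rw [hat_add]
        apply Lp.ext
        filter_upwards [hat_truncDerivFun_ae ε τ (f + g), hat_truncDerivFun_ae ε τ f,
          hat_truncDerivFun_ae ε τ g,
          Lp.coeFn_add (hat (truncDerivFun ε τ f)) (hat (truncDerivFun ε τ g)),
          Lp.coeFn_add (hat f) (hat g)] with ξ h1 h2 h3 h4 h5
        rw [h1, h4, Pi.add_apply, h2, h3, hat_add, h5, Pi.add_apply, mul_add]
      map_smul' := fun c f => by
        apply hat_injective
        rw [hat_smul]
        apply Lp.ext
        filter_upwards [hat_truncDerivFun_ae ε τ (c • f), hat_truncDerivFun_ae ε τ f,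
          Lp.coeFn_smul ((RingHom.id ℝ c : ℝ) : ℂ) (hat (truncDerivFun ε τ f)),
          Lp.coeFn_smul (c : ℂ) (hat f)] with ξ h1 h2 h3 h4
        rw [h1, h3, Pi.smul_apply, h2, hat_smul, h4, Pi.smul_apply]
        simp only [smul_eq_mul, RingHom.id_apply]
        ring }
    (∏ j, (2 * Real.pi * |1 / ε|) ^ τ j) fun f => by
      change ‖truncDerivFun ε τ f‖ ≤ _
      rw [← norm_hat, ← norm_hat f]
      refine Lp.norm_le_mul_norm_of_ae_le_mul ?_
      filter_upwards [hat_truncDerivFun_ae ε τ f] with ξ h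
      rw [h, norm_mul]
      exact mul_le_mul_of_nonneg_right (norm_symbol_le ε τ ξ) (norm_nonneg _)

theorem hat_truncDeriv_ae {d : ℕ} (ε : ℝ) (τ : Fin d → ℕ) (f : L2 d) :
    hat (truncDeriv ε τ f) =ᵐ[volume] fun ξ => symbol ε τ ξ * hat f ξ :=
  hat_truncDerivFun_ae ε τ f

theorem cutoff_eq_truncDeriv {d : ℕ} (ε : ℝ) (f : L2 d) : cutoff ε f = truncDeriv ε 0 f := by
  change realPart _ = realPart _
  congr 2
  apply Lp.ext
  filter_upwards [(memLp_symbol_mul ε 0 (hat f)).coeFn_toLp,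
    ((Lp.memLp (𝓕 (toComplex f))).indicator
      (Metric.isOpen_ball (x := (0 : Space d)) (ε := 1 / ε)).measurableSet).coeFn_toLp] with ξ h1 h2
  rw [h1, truncate, h2]
  by_cases h : ξ ∈ Metric.ball (0 : Space d) (1 / ε)
  · rw [symbol_of_mem _ h, indicator_of_mem h]
    simp [hat]
  · rw [symbol_of_notMem _ h, indicator_of_notMem h, zero_mul]

theorem truncDeriv_truncDeriv {d : ℕ} (ε : ℝ) (τ σ : Fin d → ℕ) (f : L2 d) :
    truncDeriv ε τ (truncDeriv ε σ f) = truncDeriv ε (τ + σ) f := by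
  apply hat_injective
  apply Lp.ext
  filter_upwards [hat_truncDeriv_ae ε τ (truncDeriv ε σ f), hat_truncDeriv_ae ε σ f,
    hat_truncDeriv_ae ε (τ + σ) f] with ξ h1 h2 h3
  rw [h1, h2, h3, ← symbol_mul_symbol, mul_assoc]

theorem truncDeriv_cutoff {d : ℕ} (ε : ℝ) (τ : Fin d → ℕ) (f : L2 d) :
    truncDeriv ε τ (cutoff ε f) = truncDeriv ε τ f := by
  rw [cutoff_eq_truncDeriv, truncDeriv_truncDeriv, add_zero]

/-- The first derivatives are skew-adjoint, as their symbols are purely imaginary. -/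
theorem inner_truncDeriv_truncDeriv_single {d : ℕ} (ε : ℝ) (τ : Fin d → ℕ) (a : Fin d) (f : L2 d) :
    inner ℝ (truncDeriv ε τ f) (truncDeriv ε τ (truncDeriv ε (Pi.single a 1) f)) = 0 := by
  rw [truncDeriv_truncDeriv, inner_hat, L2.inner_def]
  have h0 := L2.integrable_inner (𝕜 := ℂ) (hat (truncDeriv ε τ f))
    (hat (truncDeriv ε (τ + Pi.single a 1) f))
  have h := integral_re h0
  simp only [RCLike.re_to_complex] at h
  rw [← h]
  refine integral_eq_zero_of_ae ?_
  filter_upwards [hat_truncDeriv_ae ε τ f, hat_truncDeriv_ae ε (τ + Pi.single a 1) f] with ξ h1 h2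
  rw [h1, h2, ← symbol_mul_symbol]
  by_cases hξ : ξ ∈ Metric.ball (0 : Space d) (1 / ε)
  · have h3 : symbol ε (Pi.single a 1) ξ = ((2 * Real.pi * ξ a : ℝ) : ℂ) * Complex.I := by
      rw [symbol_of_mem _ hξ, Finset.prod_eq_single a]
      · simp; ring
      · intro b _ hb
        simp [hb]
      · simp
    rw [h3]
    have h4 : inner ℂ (symbol ε τ ξ * hat f ξ)
        (symbol ε τ ξ * (((2 * Real.pi * ξ a : ℝ) : ℂ) * Complex.I) * hat f ξ)
        = ((2 * Real.pi * ξ a * Complex.normSq (symbol ε τ ξ * hat f ξ) : ℝ) : ℂ) * Complex.I := by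
      rw [RCLike.inner_apply, Complex.ofReal_mul _ (Complex.normSq _), ← Complex.mul_conj]
      ring
    rw [h4, Complex.re_ofReal_mul, Complex.I_re, mul_zero]
    rfl
  · simp [symbol_of_notMem τ hξ]

/-! ### Identification with weak derivatives -/

/-- The Fourier multiplier `2πi ξ_j` is the distributional derivative in the direction `j`. -/
theorem lineDeriv_fourierInv {d : ℕ} (j : Fin d) {φ ψ : L2C d}
    (h : ψ =ᵐ[volume] fun ξ => (2 * Real.pi * Complex.I * (ξ j : ℂ)) * φ ξ) :
    ∂_{EuclideanSpace.single j (1 : ℝ)} ((𝓕⁻ φ : L2C d) : 𝓢'(Space d, ℂ)) = (𝓕⁻ ψ : L2C d) := by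
  rw [← Lp.fourierInv_toTemperedDistribution_eq, ← Lp.fourierInv_toTemperedDistribution_eq,
    TemperedDistribution.lineDerivOp_fourierInv_eq]
  congr 1
  ext u
  have hg : (fun x : Space d =>
      ((inner ℝ x (EuclideanSpace.single j (1 : ℝ)) : ℝ) : ℂ)).HasTemperateGrowth := by
    fun_prop
  change (2 * Real.pi * Complex.I) •
    (TemperedDistribution.smulLeftCLM ℂ _ (φ : 𝓢'(Space d, ℂ))) u = _
  rw [TemperedDistribution.smulLeftCLM_apply_apply, Lp.toTemperedDistribution_apply,
    Lp.toTemperedDistribution_apply, ← integral_smul]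
  refine integral_congr_ae ?_
  filter_upwards [h] with ξ hξ
  rw [hξ, SchwartzMap.smulLeftCLM_apply_apply hg]
  simp [EuclideanSpace.inner_single_right]
  ring

theorem toComplex_truncDeriv {d : ℕ} (ε : ℝ) (τ : Fin d → ℕ) (f : L2 d) :
    toComplex (truncDeriv ε τ f) = 𝓕⁻ (hat (truncDeriv ε τ f)) :=
  (FourierTransform.fourierInv_fourier_eq (toComplex (truncDeriv ε τ f))).symm

theorem lineDeriv_truncDeriv {d : ℕ} (ε : ℝ) (τ : Fin d → ℕ) (j : Fin d) (f : L2 d) :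
    ∂_{EuclideanSpace.single j (1 : ℝ)} (toComplex (truncDeriv ε τ f) : 𝓢'(Space d, ℂ))
      = (toComplex (truncDeriv ε (Pi.single j 1 + τ) f) : 𝓢'(Space d, ℂ)) := by
  rw [toComplex_truncDeriv, toComplex_truncDeriv]
  refine lineDeriv_fourierInv j ?_
  filter_upwards [hat_truncDeriv_ae ε τ f, hat_truncDeriv_ae ε (Pi.single j 1 + τ) f] with ξ h1 h2
  rw [h1, h2]
  by_cases hξ : ξ ∈ Metric.ball (0 : Space d) (1 / ε)
  · rw [symbol_of_mem _ hξ, symbol_of_mem _ hξ, ← mul_assoc]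
    congr 1
    simp only [Pi.add_apply, pow_add, Finset.prod_mul_distrib]
    congr 1
    rw [Finset.prod_eq_single j]
    · simp
    · intro b _ hb
      simp [hb]
    · simp
  · simp [symbol_of_notMem _ hξ]

theorem iterate_lineDeriv_truncDeriv {d : ℕ} (ε : ℝ) (τ : Fin d → ℕ) (j : Fin d) (k : ℕ)
    (f : L2 d) :
    (fun Q : 𝓢'(Space d, ℂ) => ∂_{EuclideanSpace.single j (1 : ℝ)} Q)^[k]
      (toComplex (truncDeriv ε τ f) : 𝓢'(Space d, ℂ))
      = (toComplex (truncDeriv ε (Pi.single j k + τ) f) : 𝓢'(Space d, ℂ)) := by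
  induction k with
  | zero => simp
  | succ k ih =>
    rw [Function.iterate_succ_apply', ih, lineDeriv_truncDeriv, ← add_assoc, ← Pi.single_add,
      add_comm 1 k]

theorem isWeakDeriv_cutoff {d : ℕ} (ε : ℝ) (τ : Fin d → ℕ) (f : L2 d) :
    IsWeakDeriv τ (cutoff ε f) (truncDeriv ε τ f) := by
  have key : ∀ l : List (Fin d),
      l.foldr (fun j R =>
        (fun Q : 𝓢'(Space d, ℂ) => ∂_{EuclideanSpace.single j (1 : ℝ)} Q)^[τ j] R)
        (toComplex (truncDeriv ε 0 f) : 𝓢'(Space d, ℂ))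
      = (toComplex (truncDeriv ε (l.map fun j => Pi.single j (τ j)).sum f) : 𝓢'(Space d, ℂ)) := by
    intro l
    induction l with
    | nil => simp
    | cons j l ih =>
      rw [List.foldr_cons, ih, iterate_lineDeriv_truncDeriv, List.map_cons, List.sum_cons]
  rw [IsWeakDeriv, distribDeriv, cutoff_eq_truncDeriv, key, ← List.ofFn_eq_map, List.sum_ofFn,
    Finset.univ_sum_single]

theorem weakDeriv_cutoff {d : ℕ} (ε : ℝ) (τ : Fin d → ℕ) (f : L2 d) :
    weakDeriv τ (cutoff ε f) = truncDeriv ε τ f :=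
  (isWeakDeriv_cutoff ε τ f).weakDeriv_eq

theorem memH_cutoff {d : ℕ} (m : ℕ) (ε : ℝ) (f : L2 d) : MemH m (cutoff ε f) :=
  fun τ _ => ⟨_, isWeakDeriv_cutoff ε τ f⟩

/-! ### Autonomous differential equations in Banach spaces -/

section ODE

open scoped NNReal

variable {E : Type*} [NormedAddCommGroup E] [NormedSpace ℝ E]

/-- `F` is Lipschitz on every closed ball around the origin. -/
def LipschitzOnBalls {E' : Type*} [NormedAddCommGroup E'] (F : E → E') : Prop :=
  ∀ R : ℝ, ∃ K : ℝ≥0, LipschitzOnWith K F (Metric.closedBall 0 R)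

/-- The radial retraction of a normed space onto the closed ball of radius `R > 0`. -/
noncomputable def radialRetraction (R : ℝ) (x : E) : E := (R / max R ‖x‖) • x

theorem radialRetraction_of_norm_le {R : ℝ} (hR : 0 < R) {x : E} (hx : ‖x‖ ≤ R) :
    radialRetraction R x = x := by
  rw [radialRetraction, max_eq_left hx, div_self hR.ne', one_smul]

theorem norm_radialRetraction_le {R : ℝ} (hR : 0 < R) (x : E) : ‖radialRetraction R x‖ ≤ R := by
  have h : 0 < max R ‖x‖ := lt_max_of_lt_left hR
  rw [radialRetraction, norm_smul, Real.norm_of_nonneg (by positivity), div_mul_eq_mul_div,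
    div_le_iff₀ h]
  exact mul_le_mul_of_nonneg_left (le_max_right _ _) hR.le

theorem lipschitzWith_radialRetraction {R : ℝ} (hR : 0 < R) :
    LipschitzWith 2 (radialRetraction R : E → E) := by
  refine LipschitzWith.of_dist_le_mul fun x y => ?_
  rw [dist_eq_norm, dist_eq_norm]
  have hx : 0 < max R ‖x‖ := lt_max_of_lt_left hR
  have hy : 0 < max R ‖y‖ := lt_max_of_lt_left hR
  have e : radialRetraction R x - radialRetraction R y
      = (R / max R ‖x‖) • (x - y) + (R / max R ‖x‖ - R / max R ‖y‖) • y := by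
    simp only [radialRetraction, smul_sub, sub_smul]
    abel
  have h1 : ‖(R / max R ‖x‖) • (x - y)‖ ≤ ‖x - y‖ := by
    rw [norm_smul, Real.norm_of_nonneg (by positivity)]
    exact mul_le_of_le_one_left (norm_nonneg _) (div_le_one_of_le₀ (le_max_left _ _) hx.le)
  have h2 : ‖(R / max R ‖x‖ - R / max R ‖y‖) • y‖ ≤ ‖x - y‖ := by
    have e2 : R / max R ‖x‖ - R / max R ‖y‖
        = (R / max R ‖x‖) * ((max R ‖y‖ - max R ‖x‖) / max R ‖y‖) := by
      field_simp
    have h3 : |max R ‖y‖ - max R ‖x‖| ≤ ‖x - y‖ := by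
      rw [max_comm R, max_comm R, norm_sub_rev]
      exact (abs_max_sub_max_le_abs ‖y‖ ‖x‖ R).trans (abs_norm_sub_norm_le y x)
    rw [norm_smul, e2, norm_mul, Real.norm_of_nonneg (by positivity), norm_div,
      Real.norm_of_nonneg hy.le, Real.norm_eq_abs, mul_assoc]
    refine (mul_le_of_le_one_left (by positivity)
      (div_le_one_of_le₀ (le_max_left _ _) hx.le)).trans ?_
    rw [div_mul_eq_mul_div, div_le_iff₀ hy]
    exact mul_le_mul h3 (le_max_right _ _) (norm_nonneg _) (norm_nonneg _)
  calc ‖radialRetraction R x - radialRetraction R y‖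
      ≤ ‖x - y‖ + ‖x - y‖ := by
        rw [e]
        exact (norm_add_le _ _).trans (add_le_add h1 h2)
    _ = ((2 : ℝ≥0) : ℝ) * ‖x - y‖ := by push_cast; ring

theorem lipschitzWith_comp_radialRetraction {F : E → E} {R : ℝ} (hR : 0 < R) {K : ℝ≥0}
    (hK : LipschitzOnWith K F (Metric.closedBall 0 R)) :
    LipschitzWith (K * 2) (F ∘ radialRetraction R) := by
  rw [← lipschitzOnWith_univ] at *
  exact hK.comp (lipschitzOnWith_univ.2 (lipschitzWith_radialRetraction hR))
    fun x _ => by simpa using norm_radialRetraction_le hR x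

/-- After composition with the radial retraction the vector field is bounded and Lipschitz, and so
the solution exists for all times. -/
theorem exists_isIntegralCurveOn_retraction [CompleteSpace E] {F : E → E} {R : ℝ} (hR : 0 < R)
    {K : ℝ≥0} (hK : LipschitzOnWith K F (Metric.closedBall 0 R)) {T : ℝ} (hT : 0 ≤ T) (x₀ : E) :
    ∃ x : ℝ → E, x 0 = x₀ ∧
      IsIntegralCurveOn x (fun _ => F ∘ radialRetraction R) (Icc 0 T) := by
  have hb : ∀ x, ‖(F ∘ radialRetraction R) x‖ ≤ (‖F 0‖₊ + K * ⟨R, hR.le⟩ : ℝ≥0) := by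
    intro x
    have h0 : (0 : E) ∈ Metric.closedBall (0 : E) R := by simpa using hR.le
    have hx : radialRetraction R x ∈ Metric.closedBall (0 : E) R := by
      simpa using norm_radialRetraction_le hR x
    have h1 := hK.norm_sub_le hx h0
    have h2 := norm_le_norm_add_norm_sub' (F (radialRetraction R x)) (F 0)
    rw [sub_zero] at h1
    have h3 : K * ‖radialRetraction R x‖ ≤ K * R :=
      mul_le_mul_of_nonneg_left (norm_radialRetraction_le hR x) K.2
    push_cast
    change ‖F (radialRetraction R x)‖ ≤ ‖F 0‖ + K * R
    linarith
  have hP : IsPicardLindelof (fun _ : ℝ => F ∘ radialRetraction R)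
      (⟨0, le_refl 0, hT⟩ : Icc (0 : ℝ) T) x₀
      ((‖F 0‖₊ + K * ⟨R, hR.le⟩) * ⟨T, hT⟩) 0 (‖F 0‖₊ + K * ⟨R, hR.le⟩) (K * 2) := by
    refine IsPicardLindelof.of_time_independent (fun x _ => hb x)
      (lipschitzWith_comp_radialRetraction hR hK).lipschitzOnWith ?_
    rw [sub_zero, sub_self, max_eq_left hT, NNReal.coe_zero, sub_zero]
    exact le_of_eq rfl
  exact hP.exists_eq_forall_mem_Icc_hasDerivWithinAt₀

theorem IsIntegralCurveOn.hasDerivWithinAt_Ici {G : E → E} {x : ℝ → E} {T : ℝ}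
    (hx : IsIntegralCurveOn x (fun _ => G) (Icc 0 T)) {t : ℝ} (ht : t ∈ Ico 0 T) :
    HasDerivWithinAt x (G (x t)) (Ici t) t :=
  (hx t ⟨ht.1, ht.2.le⟩).mono_of_mem_nhdsWithin
    (Filter.mem_of_superset (Icc_mem_nhdsGE ht.2) (Icc_subset_Icc_left ht.1))

theorem IsIntegralCurveOn.continuousOn_Icc {G : E → E} {x : ℝ → E} {T : ℝ}
    (hx : IsIntegralCurveOn x (fun _ => G) (Icc 0 T)) : ContinuousOn x (Icc 0 T) :=
  fun t ht => (hx t ht).continuousWithinAt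

/-- Grönwall's inequality for two solutions in a ball. -/
theorem dist_le_of_isIntegralCurveOn {F : E → E} {s : Set E} {K : ℝ≥0}
    (hK : LipschitzOnWith K F s) {T : ℝ} {x y : ℝ → E}
    (hx : IsIntegralCurveOn x (fun _ => F) (Icc 0 T))
    (hy : IsIntegralCurveOn y (fun _ => F) (Icc 0 T))
    (hxs : ∀ t ∈ Icc 0 T, x t ∈ s) (hys : ∀ t ∈ Icc 0 T, y t ∈ s)
    {t : ℝ} (ht : t ∈ Icc 0 T) : dist (x t) (y t) ≤ dist (x 0) (y 0) * Real.exp (K * t) := by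
  have := dist_le_of_trajectories_ODE_of_mem (v := fun _ => F) (s := fun _ => s) (K := K)
    (fun _ _ => hK)
    (IsIntegralCurveOn.continuousOn_Icc hx) (fun t ht => IsIntegralCurveOn.hasDerivWithinAt_Ici hx ht)
    (fun t ht => hxs t ⟨ht.1, ht.2.le⟩)
    (IsIntegralCurveOn.continuousOn_Icc hy) (fun t ht => IsIntegralCurveOn.hasDerivWithinAt_Ici hy ht)
    (fun t ht => hys t ⟨ht.1, ht.2.le⟩) le_rfl t ht
  simpa using this

theorem exists_norm_le_of_isIntegralCurveOn {F : E → E} {T : ℝ} {x : ℝ → E}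
    (hx : IsIntegralCurveOn x (fun _ => F) (Icc 0 T)) :
    ∃ R : ℝ, 0 < R ∧ ∀ t ∈ Icc 0 T, ‖x t‖ ≤ R := by
  obtain ⟨R, hR⟩ := isCompact_Icc.exists_bound_of_continuousOn
    (IsIntegralCurveOn.continuousOn_Icc hx)
  exact ⟨max R 1, by positivity, fun t ht => (hR t ht).trans (le_max_left _ _)⟩

theorem eqOn_of_isIntegralCurveOn {F : E → E} (hF : LipschitzOnBalls F) {T : ℝ} {x y : ℝ → E}
    (hx : IsIntegralCurveOn x (fun _ => F) (Icc 0 T))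
    (hy : IsIntegralCurveOn y (fun _ => F) (Icc 0 T)) (h0 : x 0 = y 0) :
    EqOn x y (Icc 0 T) := by
  intro t ht
  obtain ⟨R₁, -, h₁⟩ := exists_norm_le_of_isIntegralCurveOn hx
  obtain ⟨R₂, -, h₂⟩ := exists_norm_le_of_isIntegralCurveOn hy
  obtain ⟨K, hK⟩ := hF (max R₁ R₂)
  have := dist_le_of_isIntegralCurveOn hK hx hy
    (fun s hs => by simpa using Or.inl (h₁ s hs)) (fun s hs => by simpa using Or.inr (h₂ s hs)) ht
  rw [h0, dist_self, zero_mul] at this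
  exact dist_le_zero.1 this

/-- A vector field that is Lipschitz on balls has a solution on `[0,T]` if all solutions on shorter
intervals obey an a priori bound. -/
theorem exists_isIntegralCurveOn_of_apriori_bound [CompleteSpace E] {F : E → E}
    (hF : LipschitzOnBalls F) {T R : ℝ} (hT : 0 ≤ T) (x₀ : E)
    (hbound : ∀ t ∈ Icc 0 T, ∀ x : ℝ → E, x 0 = x₀ →
      IsIntegralCurveOn x (fun _ => F) (Icc 0 t) → ‖x t‖ ≤ R) :
    ∃ x : ℝ → E, x 0 = x₀ ∧ IsIntegralCurveOn x (fun _ => F) (Icc 0 T) := by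
  -- The a priori bound on the degenerate interval `[0,0]` bounds the initial value.
  have hx₀ : ‖x₀‖ ≤ R := by
    refine hbound 0 ⟨le_rfl, hT⟩ (fun _ => x₀) rfl fun t ht => ?_
    rw [Icc_self, mem_singleton_iff] at ht
    rw [Icc_self, ht]
    rw [hasDerivWithinAt_iff_tendsto_slope]
    simp
  have hR : 0 < R + 1 := by linarith [norm_nonneg x₀]
  obtain ⟨K, hK⟩ := hF (R + 1)
  obtain ⟨x, hx0, hx⟩ := exists_isIntegralCurveOn_retraction hR hK hT x₀
  have hcurve : ∀ t ∈ Icc 0 T, (∀ s ∈ Icc 0 t, ‖x s‖ ≤ R + 1) →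
      IsIntegralCurveOn x (fun _ => F) (Icc 0 t) := by
    intro t ht h s hs
    have h1 := (hx s ⟨hs.1, hs.2.trans ht.2⟩).mono (Icc_subset_Icc_right ht.2)
    simpa [radialRetraction_of_norm_le hR (h s hs)] using h1
  have hc : ContinuousOn (fun t => ‖x t‖) (Icc 0 T) :=
    (IsIntegralCurveOn.continuousOn_Icc hx).norm
  -- At the first time at which the norm reached `R + 1`, the a priori bound would be violated.
  have hle : ∀ t ∈ Icc 0 T, ‖x t‖ ≤ R + 1 := by
    by_contra! hcon
    obtain ⟨t₁, ht₁, hxt₁⟩ := hcon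
    have hclosed : IsCompact (Icc 0 T ∩ (fun t => ‖x t‖) ⁻¹' Ici (R + 1)) :=
      isCompact_Icc.of_isClosed_subset (hc.preimage_isClosed_of_isClosed isClosed_Icc isClosed_Ici)
        inter_subset_left
    obtain ⟨τ, ⟨hτ, hτR⟩, hmin⟩ := hclosed.exists_isLeast ⟨t₁, ht₁, hxt₁.le⟩
    have hlt : ∀ s ∈ Ico 0 τ, ‖x s‖ < R + 1 := by
      intro s hs
      by_contra! h
      exact absurd (hmin ⟨⟨hs.1, hs.2.le.trans hτ.2⟩, h⟩) (not_le.2 hs.2)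
    have hτpos : 0 < τ := by
      rcases hτ.1.eq_or_lt with h | h
      · rw [← h] at hτR
        simp only [mem_preimage, mem_Ici, hx0] at hτR
        linarith
      · exact h
    have hτle : ‖x τ‖ ≤ R + 1 := by
      have hcl : τ ∈ closure (Ico 0 τ) := by
        rw [closure_Ico hτpos.ne]
        exact ⟨hτ.1, le_rfl⟩
      have : ContinuousWithinAt (fun t => ‖x t‖) (Ico 0 τ) τ :=
        (hc τ hτ).mono fun s hs => ⟨hs.1, hs.2.le.trans hτ.2⟩
      exact closure_minimal (by rintro _ ⟨s, hs, rfl⟩; exact (hlt s hs).le) isClosed_Iic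
        (this.mem_closure_image hcl)
    have := hbound τ hτ x hx0 (hcurve τ hτ fun s hs => by
      rcases hs.2.eq_or_lt with h | h
      · rwa [h]
      · exact (hlt s ⟨hs.1, h⟩).le)
    simp only [mem_preimage, mem_Ici] at hτR
    linarith
  exact ⟨x, hx0, hcurve T ⟨hT, le_rfl⟩ hle⟩

/-- Solutions on a compact interval persist under perturbation of the initial value. -/
theorem exists_isIntegralCurveOn_near [CompleteSpace E] {F : E → E} (hF : LipschitzOnBalls F)
    {T : ℝ} (hT : 0 ≤ T) {x : ℝ → E} (hx : IsIntegralCurveOn x (fun _ => F) (Icc 0 T))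
    {δ : ℝ} (hδ : 0 < δ) :
    ∃ η : ℝ, 0 < η ∧ ∀ y₀ : E, dist y₀ (x 0) < η →
      ∃ y : ℝ → E, y 0 = y₀ ∧ IsIntegralCurveOn y (fun _ => F) (Icc 0 T) ∧
        ∀ t ∈ Icc 0 T, dist (y t) (x t) < δ := by
  obtain ⟨R, hR, hxR⟩ := exists_norm_le_of_isIntegralCurveOn hx
  have hR1 : 0 < R + 1 := by linarith
  obtain ⟨K, hK⟩ := hF (R + 1)
  refine ⟨min 1 δ * Real.exp (-((K * 2 : ℝ≥0) * T)), by positivity, fun y₀ hy₀ => ?_⟩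
  obtain ⟨y, hy0, hy⟩ := exists_isIntegralCurveOn_retraction hR1 hK hT y₀
  -- Both curves are compared as solutions of the globally Lipschitz retracted equation; the perturbed
  -- one stays within distance `1` of `x`, hence in the ball in which the retraction is the identity.
  have hx' : IsIntegralCurveOn x (fun _ => F ∘ radialRetraction (R + 1)) (Icc 0 T) := by
    intro t ht
    have h := hx t ht
    have e : (F ∘ radialRetraction (R + 1)) (x t) = F (x t) := by
      rw [Function.comp_apply,
        radialRetraction_of_norm_le hR1 ((hxR t ht).trans (by linarith))]
    simpa only [e] using h
  have hd : ∀ t ∈ Icc 0 T, dist (y t) (x t) < min 1 δ := by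
    intro t ht
    have h1 := dist_le_of_isIntegralCurveOn (s := univ)
      (lipschitzWith_comp_radialRetraction hR1 hK).lipschitzOnWith
      hy hx' (fun _ _ => mem_univ _) (fun _ _ => mem_univ _) ht
    refine h1.trans_lt ?_
    rw [hy0]
    calc dist y₀ (x 0) * Real.exp ((K * 2 : ℝ≥0) * t)
        ≤ dist y₀ (x 0) * Real.exp ((K * 2 : ℝ≥0) * T) := by
          gcongr
          exact ht.2
      _ < min 1 δ * Real.exp (-((K * 2 : ℝ≥0) * T)) * Real.exp ((K * 2 : ℝ≥0) * T) := by
          gcongr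
      _ = min 1 δ := by rw [mul_assoc, ← Real.exp_add]; simp
  refine ⟨y, hy0, fun t ht => ?_, fun t ht => (hd t ht).trans_le (min_le_right _ _)⟩
  have h := hy t ht
  have hyR : ‖y t‖ ≤ R + 1 := by
    have h1 := (hd t ht).trans_le (min_le_left _ _)
    rw [dist_eq_norm] at h1
    have h2 := norm_le_norm_add_norm_sub' (y t) (x t)
    linarith [hxR t ht]
  have e : (F ∘ radialRetraction (R + 1)) (y t) = F (y t) := by
    rw [Function.comp_apply, radialRetraction_of_norm_le hR1 hyR]
  simpa only [e] using h

end ODE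

/-! ### Weighted convolution estimates -/

section Convolution

open scoped ENNReal

/-- The Cauchy-Schwarz inequality, squared. -/
theorem sq_lintegral_mul_le {α : Type*} [MeasurableSpace α] {μ : Measure α} {f g : α → ℝ≥0∞}
    (hf : Measurable f) (hg : Measurable g) :
    (∫⁻ x, f x * g x ∂μ) ^ 2 ≤ (∫⁻ x, f x ^ 2 ∂μ) * ∫⁻ x, g x ^ 2 ∂μ := by
  have h := ENNReal.lintegral_mul_le_Lp_mul_Lq μ Real.HolderConjugate.two_two hf.aemeasurable
    hg.aemeasurable
  simp only [Pi.mul_apply, ENNReal.rpow_two] at h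
  refine (pow_le_pow_left₀ zero_le h 2).trans (le_of_eq ?_)
  rw [mul_pow, ← ENNReal.rpow_natCast, ← ENNReal.rpow_natCast, ← ENNReal.rpow_mul,
    ← ENNReal.rpow_mul]
  norm_num

/-- `L²` with respect to a weight with square integrable inverse embeds into `L¹`. -/
theorem sq_lintegral_le_of_weight {α : Type*} [MeasurableSpace α] {μ : Measure α}
    {p a : α → ℝ≥0∞} (hp : Measurable p) (ha : Measurable a)
    (hp0 : ∀ x, p x ≠ 0) (hpt : ∀ x, p x ≠ ∞) :
    (∫⁻ x, a x ∂μ) ^ 2 ≤ (∫⁻ x, (p x)⁻¹ ^ 2 ∂μ) * ∫⁻ x, (p x * a x) ^ 2 ∂μ := by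
  have h := sq_lintegral_mul_le (μ := μ) (f := fun x => (p x)⁻¹) (g := fun x => p x * a x)
    (by fun_prop) (by fun_prop)
  simpa only [← mul_assoc, ENNReal.inv_mul_cancel (hp0 _) (hpt _), one_mul] using h

variable {G : Type*} [AddCommGroup G] [MeasurableSpace G] [MeasurableAdd₂ G] [MeasurableNeg G]
  {μ : Measure G} [SFinite μ] [μ.IsAddLeftInvariant]

/-- Young's inequality `‖a ⋆ b‖_{L²} ≤ ‖a‖_{L¹} ‖b‖_{L²}`. -/
theorem lintegral_sq_lconvolution_le {a b : G → ℝ≥0∞} (ha : Measurable a) (hb : Measurable b) :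
    ∫⁻ x, (a ⋆ₗ[μ] b) x ^ 2 ∂μ ≤ (∫⁻ x, a x ∂μ) ^ 2 * ∫⁻ x, b x ^ 2 ∂μ := by
  have h1 : ∀ x, (a ⋆ₗ[μ] b) x ^ 2 ≤ (∫⁻ y, a y ∂μ) * ∫⁻ y, a y * b (-y + x) ^ 2 ∂μ := by
    intro x
    -- Cauchy-Schwarz with `a · b = √a · (√a b)`
    have hroot : ∀ y, a y ^ (1 / 2 : ℝ) * a y ^ (1 / 2 : ℝ) = a y := fun y => by
      rw [← ENNReal.rpow_add_of_nonneg _ _ (by norm_num) (by norm_num)]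
      norm_num
    have h := sq_lintegral_mul_le (μ := μ) (f := fun y => a y ^ (1 / 2 : ℝ))
      (g := fun y => a y ^ (1 / 2 : ℝ) * b (-y + x)) (by fun_prop) (by fun_prop)
    simp only [mul_pow, ← mul_assoc, hroot, pow_two (a _ ^ (1 / 2 : ℝ))] at h
    exact h
  calc ∫⁻ x, (a ⋆ₗ[μ] b) x ^ 2 ∂μ
      ≤ ∫⁻ x, (∫⁻ y, a y ∂μ) * ∫⁻ y, a y * b (-y + x) ^ 2 ∂μ ∂μ := lintegral_mono h1
    _ = (∫⁻ y, a y ∂μ) * ∫⁻ x, ∫⁻ y, a y * b (-y + x) ^ 2 ∂μ ∂μ :=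
        lintegral_const_mul _ (Measurable.lintegral_prod_right (by fun_prop))
    _ = (∫⁻ y, a y ∂μ) * ∫⁻ y, ∫⁻ x, a y * b (-y + x) ^ 2 ∂μ ∂μ := by
        rw [lintegral_lintegral_swap (by fun_prop)]
    _ = (∫⁻ y, a y ∂μ) * ∫⁻ y, a y * ∫⁻ x, b x ^ 2 ∂μ ∂μ := by
        congr 1
        refine lintegral_congr fun y => ?_
        rw [lintegral_const_mul _ (by fun_prop),
          lintegral_add_left_eq_self (fun x => b x ^ 2) (-y)]
    _ = (∫⁻ x, a x ∂μ) ^ 2 * ∫⁻ x, b x ^ 2 ∂μ := by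
        rw [lintegral_mul_const _ ha, pow_two, mul_assoc]

/-- Weighted `L²` functions form an algebra under convolution, provided that the weight `p` is
subadditive up to a constant and `p⁻¹` is square integrable. -/
theorem lintegral_sq_weight_mul_lconvolution_le [μ.IsNegInvariant] {p a b : G → ℝ≥0∞} {c : ℝ≥0∞}
    (hp : Measurable p) (ha : Measurable a) (hb : Measurable b)
    (hp0 : ∀ x, p x ≠ 0) (hpt : ∀ x, p x ≠ ∞) (hsub : ∀ x y, p x ≤ c * (p y + p (-y + x))) :
    ∫⁻ x, (p x * (a ⋆ₗ[μ] b) x) ^ 2 ∂μ ≤ 4 * c ^ 2 * (∫⁻ x, (p x)⁻¹ ^ 2 ∂μ) *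
      (∫⁻ x, (p x * a x) ^ 2 ∂μ) * ∫⁻ x, (p x * b x) ^ 2 ∂μ := by
  set I := ∫⁻ x, (p x)⁻¹ ^ 2 ∂μ
  set N := ∫⁻ x, (p x * a x) ^ 2 ∂μ with hN
  set M := ∫⁻ x, (p x * b x) ^ 2 ∂μ with hM
  have hpa : Measurable (fun x => p x * a x) := hp.mul ha
  have hpb : Measurable (fun x => p x * b x) := hp.mul hb
  have h1 : ∀ x, p x * (a ⋆ₗ[μ] b) x
      ≤ c * ((b ⋆ₗ[μ] (fun x => p x * a x)) x + (a ⋆ₗ[μ] (fun x => p x * b x)) x) := by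
    intro x
    rw [lconvolution_comm (f := b), lconvolution_def, lconvolution_def, lconvolution_def,
      ← lintegral_add_left (by fun_prop), ← lintegral_const_mul _ (by fun_prop),
      ← lintegral_const_mul _ (by fun_prop)]
    refine lintegral_mono fun y => ?_
    calc p x * (a y * b (-y + x)) ≤ c * (p y + p (-y + x)) * (a y * b (-y + x)) := by
          gcongr
          exact hsub x y
      _ = c * (p y * a y * b (-y + x) + a y * (p (-y + x) * b (-y + x))) := by ring
  have h2 : ∀ s t : ℝ≥0∞, (s + t) ^ 2 ≤ 2 * (s ^ 2 + t ^ 2) := by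
    intro s t
    have := ENNReal.rpow_add_le_mul_rpow_add_rpow s t (p := 2) (by norm_num)
    norm_num at this
    exact this
  have ha1 : (∫⁻ x, a x ∂μ) ^ 2 ≤ I * N := sq_lintegral_le_of_weight hp ha hp0 hpt
  have hb1 : (∫⁻ x, b x ∂μ) ^ 2 ≤ I * M := sq_lintegral_le_of_weight hp hb hp0 hpt
  calc ∫⁻ x, (p x * (a ⋆ₗ[μ] b) x) ^ 2 ∂μ
      ≤ ∫⁻ x, c ^ 2 * (2 * ((b ⋆ₗ[μ] (fun x => p x * a x)) x ^ 2
          + (a ⋆ₗ[μ] (fun x => p x * b x)) x ^ 2)) ∂μ := by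
        refine lintegral_mono fun x => ?_
        refine (pow_le_pow_left₀ zero_le (h1 x) 2).trans ?_
        rw [mul_pow]
        gcongr
        exact h2 _ _
    _ = c ^ 2 * (2 * ((∫⁻ x, (b ⋆ₗ[μ] (fun x => p x * a x)) x ^ 2 ∂μ)
          + ∫⁻ x, (a ⋆ₗ[μ] (fun x => p x * b x)) x ^ 2 ∂μ)) := by
        have m1 : Measurable (b ⋆ₗ[μ] (fun x => p x * a x)) := measurable_lconvolution μ hb hpa
        have m2 : Measurable (a ⋆ₗ[μ] (fun x => p x * b x)) := measurable_lconvolution μ ha hpb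
        rw [lintegral_const_mul _ (by fun_prop), lintegral_const_mul _ (by fun_prop),
          lintegral_add_left (by fun_prop)]
    _ ≤ c ^ 2 * (2 * (I * M * N + I * N * M)) := by
        gcongr
        · exact (lintegral_sq_lconvolution_le hb hpa).trans (by gcongr)
        · exact (lintegral_sq_lconvolution_le ha hpb).trans (by gcongr)
    _ = 4 * c ^ 2 * I * N * M := by ring

end Convolution

/-! ### Sobolev norms of band-limited functions -/

/-- `∑_{|τ| ≤ m} ‖∂^τ Λ_ε f‖²_{L²}`. -/
noncomputable def bandNormSq {d : ℕ} (ε : ℝ) (m : ℕ) (f : L2 d) : ℝ :=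
  ∑ k ∈ Finset.range (m + 1), ∑ τ ∈ Finset.piAntidiag (Finset.univ : Finset (Fin d)) k,
    ‖truncDeriv ε τ f‖ ^ 2

theorem sobolevNormSq_cutoff {d : ℕ} (ε : ℝ) (m : ℕ) (f : L2 d) :
    sobolevNormSq m (cutoff ε f) = bandNormSq ε m f := by
  simp only [sobolevNormSq, bandNormSq, weakDeriv_cutoff]

theorem bandNormSq_nonneg {d : ℕ} (ε : ℝ) (m : ℕ) (f : L2 d) : 0 ≤ bandNormSq ε m f :=
  Finset.sum_nonneg fun _ _ => Finset.sum_nonneg fun _ _ => sq_nonneg _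

theorem zero_mem_piAntidiag {d : ℕ} :
    (0 : Fin d → ℕ) ∈ Finset.piAntidiag (Finset.univ : Finset (Fin d)) 0 := by
  simp

theorem norm_sq_cutoff_le_bandNormSq {d : ℕ} (ε : ℝ) (m : ℕ) (f : L2 d) :
    ‖cutoff ε f‖ ^ 2 ≤ bandNormSq ε m f := by
  rw [cutoff_eq_truncDeriv]
  have h1 : ‖truncDeriv ε 0 f‖ ^ 2
      ≤ ∑ τ ∈ Finset.piAntidiag (Finset.univ : Finset (Fin d)) 0, ‖truncDeriv ε τ f‖ ^ 2 :=
    Finset.single_le_sum (f := fun τ => ‖truncDeriv ε τ f‖ ^ 2) (fun _ _ => sq_nonneg _)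
      zero_mem_piAntidiag
  refine h1.trans (Finset.single_le_sum (f := fun k =>
    ∑ τ ∈ Finset.piAntidiag (Finset.univ : Finset (Fin d)) k, ‖truncDeriv ε τ f‖ ^ 2)
    (fun _ _ => Finset.sum_nonneg fun _ _ => sq_nonneg _) ?_)
  simp

/-- The symbol `∑_{|τ| ≤ m} ∏_j |2π ξ_j|^{2 τ_j}` of the squared Sobolev norm. -/
noncomputable def sobolevWeight {d : ℕ} (m : ℕ) (ξ : Space d) : ℝ :=
  ∑ k ∈ Finset.range (m + 1), ∑ τ ∈ Finset.piAntidiag (Finset.univ : Finset (Fin d)) k,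
    ∏ j, ((2 * Real.pi * ξ j) ^ 2) ^ τ j

theorem one_add_norm_pow_le_sobolevWeight {d m : ℕ} (hd : 0 < d) (ξ : Space d) :
    ((1 + ‖ξ‖) ^ m) ^ 2 ≤ 4 ^ m * (1 + d ^ m) * sobolevWeight m ξ := by
  have hterm : ∀ k ≤ m, ∀ τ ∈ Finset.piAntidiag (Finset.univ : Finset (Fin d)) k,
      ∏ j, ((2 * Real.pi * ξ j) ^ 2) ^ τ j ≤ sobolevWeight m ξ := by
    intro k hk τ hτ
    have h1 := Finset.single_le_sum (f := fun τ : Fin d → ℕ => ∏ j, ((2 * Real.pi * ξ j) ^ 2) ^ τ j)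
      (fun _ _ => by positivity) hτ
    refine h1.trans (Finset.single_le_sum (f := fun k =>
      ∑ τ ∈ Finset.piAntidiag (Finset.univ : Finset (Fin d)) k,
        ∏ j, ((2 * Real.pi * ξ j) ^ 2) ^ τ j) (fun _ _ => by positivity) ?_)
    simpa using Nat.lt_succ_of_le hk
  have h0 : 1 ≤ sobolevWeight m ξ := by simpa using hterm 0 (Nat.zero_le _) 0 zero_mem_piAntidiag
  -- Up to the factor `d`, the norm is controlled by the largest coordinate `ξ_j`, and the pure
  -- derivative `∂_j^m` contributes `ξ_j^{2m}` to the symbol.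
  have : Nonempty (Fin d) := ⟨⟨0, hd⟩⟩
  obtain ⟨j, -, hj⟩ := Finset.exists_max_image Finset.univ (fun j => ξ j ^ 2)
    Finset.univ_nonempty
  have h2 : (ξ j ^ 2) ^ m ≤ sobolevWeight m ξ := by
    have h := hterm m le_rfl (Pi.single j m) (by simp [Finset.mem_piAntidiag])
    rw [Finset.prod_eq_single j (fun b _ hb => by simp [hb]) (by simp), Pi.single_eq_same] at h
    refine le_trans (pow_le_pow_left₀ (sq_nonneg _) ?_ m) h
    rw [mul_pow]
    have : 1 ≤ (2 * Real.pi) ^ 2 := one_le_pow₀ (by nlinarith [Real.pi_gt_three])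
    nlinarith [sq_nonneg (ξ j)]
  have h3 : ‖ξ‖ ^ 2 ≤ d * ξ j ^ 2 := by
    rw [EuclideanSpace.real_norm_sq_eq]
    calc ∑ i, ξ i ^ 2 ≤ ∑ _i : Fin d, ξ j ^ 2 := Finset.sum_le_sum fun i _ => hj i (by simp)
      _ = d * ξ j ^ 2 := by simp
  have h4 : (‖ξ‖ ^ 2) ^ m ≤ d ^ m * sobolevWeight m ξ := by
    refine (pow_le_pow_left₀ (sq_nonneg _) h3 m).trans ?_
    rw [mul_pow]
    gcongr
  have h5 : (1 + ‖ξ‖) ^ 2 ≤ 4 * max 1 (‖ξ‖ ^ 2) := by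
    rcases le_total ‖ξ‖ 1 with h | h
    · nlinarith [norm_nonneg ξ, le_max_left 1 (‖ξ‖ ^ 2)]
    · nlinarith [norm_nonneg ξ, le_max_right 1 (‖ξ‖ ^ 2)]
  have h6 : (max 1 (‖ξ‖ ^ 2)) ^ m ≤ (1 + d ^ m) * sobolevWeight m ξ := by
    rcases le_total (‖ξ‖ ^ 2) 1 with h | h
    · rw [max_eq_left h, one_pow]
      nlinarith [pow_nonneg (Nat.cast_nonneg (α := ℝ) d) m]
    · rw [max_eq_right h]
      linarith
  calc ((1 + ‖ξ‖) ^ m) ^ 2 = ((1 + ‖ξ‖) ^ 2) ^ m := pow_right_comm _ _ _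
    _ ≤ (4 * max 1 (‖ξ‖ ^ 2)) ^ m := pow_le_pow_left₀ (sq_nonneg _) h5 m
    _ = 4 ^ m * (max 1 (‖ξ‖ ^ 2)) ^ m := mul_pow _ _ _
    _ ≤ 4 ^ m * ((1 + d ^ m) * sobolevWeight m ξ) := by gcongr
    _ = _ := by ring

/-- The constant in the comparison of the symbol of the Sobolev norm with `(1 + |ξ|)^{2m}`. -/
noncomputable def sobolevWeightConst (d m : ℕ) : ℝ :=
  ∑ k ∈ Finset.range (m + 1), ∑ _τ ∈ Finset.piAntidiag (Finset.univ : Finset (Fin d)) k,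
    ((2 * Real.pi) ^ m) ^ 2

theorem sobolevWeight_le {d m : ℕ} (ξ : Space d) :
    sobolevWeight m ξ ≤ sobolevWeightConst d m * ((1 + ‖ξ‖) ^ m) ^ 2 := by
  rw [sobolevWeightConst, Finset.sum_mul]
  refine Finset.sum_le_sum fun k hk => ?_
  rw [Finset.sum_mul]
  refine Finset.sum_le_sum fun τ hτ => ?_
  have hk' : k ≤ m := Nat.lt_succ_iff.1 (Finset.mem_range.1 hk)
  have hτ' : ∑ j, τ j = k := by simpa [Finset.mem_piAntidiag] using hτ
  have h1 : 1 ≤ 2 * Real.pi * (1 + ‖ξ‖) := by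
    nlinarith [Real.pi_gt_three, norm_nonneg ξ, mul_nonneg Real.pi_pos.le (norm_nonneg ξ)]
  calc ∏ j, ((2 * Real.pi * ξ j) ^ 2) ^ τ j
      ≤ ∏ j, ((2 * Real.pi * (1 + ‖ξ‖)) ^ 2) ^ τ j := by
        refine Finset.prod_le_prod (fun _ _ => by positivity) fun j _ => ?_
        refine pow_le_pow_left₀ (sq_nonneg _) ?_ _
        rw [mul_pow, mul_pow _ (1 + ‖ξ‖)]
        have h2 : |ξ j| ≤ 1 + ‖ξ‖ := by
          have := PiLp.norm_apply_le ξ j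
          rw [Real.norm_eq_abs] at this
          linarith
        have h3 : ξ j ^ 2 ≤ (1 + ‖ξ‖) ^ 2 := sq_le_sq' (by linarith [neg_abs_le (ξ j)])
          ((le_abs_self _).trans h2)
        gcongr
    _ = ((2 * Real.pi * (1 + ‖ξ‖)) ^ k) ^ 2 := by
        rw [Finset.prod_pow_eq_pow_sum, hτ']
        exact pow_right_comm _ _ _
    _ ≤ ((2 * Real.pi * (1 + ‖ξ‖)) ^ m) ^ 2 := by gcongr
    _ = ((2 * Real.pi) ^ m) ^ 2 * ((1 + ‖ξ‖) ^ m) ^ 2 := by rw [mul_pow, mul_pow]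

/-! ### The Sobolev norm as a weighted norm of the Fourier transform -/

section Weight

open scoped ENNReal

theorem ofReal_norm_sq_eq_lintegral {d : ℕ} (φ : L2C d) :
    ENNReal.ofReal (‖φ‖ ^ 2) = ∫⁻ ξ, ‖φ ξ‖ₑ ^ 2 := by
  have h := eLpNorm_nnreal_pow_eq_lintegral (f := φ) (μ := volume) (p := 2) (by norm_num)
  simp only [NNReal.coe_ofNat, ENNReal.rpow_two, ENNReal.coe_ofNat] at h
  rw [← h, ← Lp.enorm_def, ENNReal.ofReal_pow (norm_nonneg _), ofReal_norm]

theorem hat_cutoff_ae {d : ℕ} (ε : ℝ) (f : L2 d) : hat (cutoff ε f) =ᵐ[volume]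
    (Metric.ball (0 : Space d) (1 / ε)).indicator (hat f) := by
  rw [cutoff_eq_truncDeriv]
  filter_upwards [hat_truncDeriv_ae ε 0 f] with ξ h
  rw [h]
  by_cases hξ : ξ ∈ Metric.ball (0 : Space d) (1 / ε)
  · rw [symbol_of_mem _ hξ, indicator_of_mem hξ]
    simp
  · rw [symbol_of_notMem _ hξ, indicator_of_notMem hξ, zero_mul]

theorem enorm_sq_symbol_mul {d : ℕ} (ε : ℝ) (τ : Fin d → ℕ) (ξ : Space d) (z : ℂ) :
    ‖symbol ε τ ξ * z‖ₑ ^ 2 = ENNReal.ofReal (∏ j, ((2 * Real.pi * ξ j) ^ 2) ^ τ j) *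
      ‖(Metric.ball (0 : Space d) (1 / ε)).indicator (fun _ => z) ξ‖ₑ ^ 2 := by
  by_cases hξ : ξ ∈ Metric.ball (0 : Space d) (1 / ε)
  · rw [symbol_of_mem _ hξ, indicator_of_mem hξ, enorm_mul, mul_pow]
    congr 1
    rw [← ofReal_norm, ← ENNReal.ofReal_pow (norm_nonneg _), norm_prod, ← Finset.prod_pow]
    congr 1
    refine Finset.prod_congr rfl fun j _ => ?_
    rw [norm_pow, pow_right_comm]
    congr 1
    simp [mul_pow, abs_of_pos Real.pi_pos]
  · rw [symbol_of_notMem _ hξ, indicator_of_notMem hξ]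
    simp

theorem ofReal_bandNormSq {d : ℕ} (ε : ℝ) (m : ℕ) (f : L2 d) :
    ENNReal.ofReal (bandNormSq ε m f)
      = ∫⁻ ξ, ENNReal.ofReal (sobolevWeight m ξ) * ‖hat (cutoff ε f) ξ‖ₑ ^ 2 := by
  have h1 : ∀ τ : Fin d → ℕ, ENNReal.ofReal (‖truncDeriv ε τ f‖ ^ 2)
      = ∫⁻ ξ, ENNReal.ofReal (∏ j, ((2 * Real.pi * ξ j) ^ 2) ^ τ j)
        * ‖hat (cutoff ε f) ξ‖ₑ ^ 2 := by
    intro τ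
    rw [← norm_hat, ofReal_norm_sq_eq_lintegral]
    refine lintegral_congr_ae ?_
    filter_upwards [hat_truncDeriv_ae ε τ f, hat_cutoff_ae ε f] with ξ h2 h3
    rw [h2, h3, enorm_sq_symbol_mul]
    rfl
  have hmeas : ∀ τ : Fin d → ℕ, Measurable fun ξ : Space d =>
      ENNReal.ofReal (∏ j, ((2 * Real.pi * ξ j) ^ 2) ^ τ j) * ‖hat (cutoff ε f) ξ‖ₑ ^ 2 := by
    intro τ
    refine Measurable.mul (Measurable.ennreal_ofReal (Continuous.measurable (by fun_prop))) ?_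
    exact (Lp.stronglyMeasurable _).measurable.enorm.pow_const 2
  rw [bandNormSq, ENNReal.ofReal_sum_of_nonneg fun _ _ => Finset.sum_nonneg fun _ _ => sq_nonneg _]
  simp only [ENNReal.ofReal_sum_of_nonneg fun _ _ => sq_nonneg _, h1]
  rw [Finset.sum_congr rfl fun k _ => (lintegral_finsetSum _ fun τ _ => hmeas τ).symm,
    ← lintegral_finsetSum _ fun k _ => Finset.measurable_sum _ fun τ _ => hmeas τ]
  refine lintegral_congr fun ξ => ?_
  rw [sobolevWeight, ENNReal.ofReal_sum_of_nonneg fun _ _ =>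
    Finset.sum_nonneg fun _ _ => by positivity, Finset.sum_mul]
  refine Finset.sum_congr rfl fun k _ => ?_
  rw [ENNReal.ofReal_sum_of_nonneg fun _ _ => by positivity, Finset.sum_mul]

/-- The weight `(1 + |ξ|)^m`. -/
noncomputable def weight {d : ℕ} (m : ℕ) (ξ : Space d) : ℝ≥0∞ := ENNReal.ofReal ((1 + ‖ξ‖) ^ m)

theorem measurable_weight {d : ℕ} (m : ℕ) : Measurable (weight (d := d) m) :=
  Measurable.ennreal_ofReal (Continuous.measurable (by fun_prop))

theorem weight_ne_zero {d : ℕ} (m : ℕ) (ξ : Space d) : weight m ξ ≠ 0 := by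
  have : 0 < (1 + ‖ξ‖) ^ m := by positivity
  simpa [weight] using this

theorem weight_ne_top {d : ℕ} (m : ℕ) (ξ : Space d) : weight m ξ ≠ ∞ := ENNReal.ofReal_ne_top

theorem weight_sq {d : ℕ} (m : ℕ) (ξ : Space d) :
    weight m ξ ^ 2 = ENNReal.ofReal (((1 + ‖ξ‖) ^ m) ^ 2) :=
  (ENNReal.ofReal_pow (by positivity) 2).symm

theorem weight_le {d : ℕ} (m : ℕ) (ξ η : Space d) :
    weight m ξ ≤ 2 ^ m * (weight m η + weight m (-η + ξ)) := by
  have h : (1 + ‖ξ‖) ^ m ≤ 2 ^ m * ((1 + ‖η‖) ^ m + (1 + ‖-η + ξ‖) ^ m) := by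
    have h1 : ‖ξ‖ ≤ ‖η‖ + ‖-η + ξ‖ := by
      simpa using norm_add_le η (-η + ξ)
    have h2 : 1 + ‖ξ‖ ≤ 2 * max (1 + ‖η‖) (1 + ‖-η + ξ‖) := by
      linarith [le_max_left (1 + ‖η‖) (1 + ‖-η + ξ‖), le_max_right (1 + ‖η‖) (1 + ‖-η + ξ‖)]
    refine (pow_le_pow_left₀ (by positivity) h2 m).trans ?_
    rw [mul_pow]
    gcongr
    have h3 : 0 ≤ (1 + ‖η‖) ^ m := by positivity
    have h4 : 0 ≤ (1 + ‖-η + ξ‖) ^ m := by positivity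
    rcases max_cases (1 + ‖η‖) (1 + ‖-η + ξ‖) with h | h <;> rw [h.1] <;> linarith
  rw [weight, weight, weight, ← ENNReal.ofReal_add (by positivity) (by positivity)]
  refine (ENNReal.ofReal_le_ofReal h).trans (le_of_eq ?_)
  rw [ENNReal.ofReal_mul (by positivity), ENNReal.ofReal_pow (by norm_num)]
  simp

/-- `(1 + |ξ|)^{-m}` is square integrable; `m > d / 2` would suffice. -/
theorem lintegral_inv_weight_sq_lt_top {d m : ℕ} (hm : d < m) :
    ∫⁻ ξ : Space d, (weight m ξ)⁻¹ ^ 2 < ∞ := by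
  have h : (Module.finrank ℝ (Space d) : ℝ) < ((2 * m : ℕ) : ℝ) := by
    rw [finrank_euclideanSpace_fin]
    exact_mod_cast (by omega : d < 2 * m)
  have := finite_integral_one_add_norm (μ := (volume : Measure (Space d))) h
  refine lt_of_eq_of_lt (lintegral_congr fun ξ => ?_) this
  rw [weight, ← ENNReal.ofReal_inv_of_pos (by positivity), ← ENNReal.ofReal_pow (by positivity),
    Real.rpow_neg (by positivity), Real.rpow_natCast, inv_pow, ← pow_mul, mul_comm 2 m]

theorem lintegral_weight_hat_cutoff_le {d m : ℕ} (hd : 0 < d) (ε : ℝ) (f : L2 d) :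
    ∫⁻ ξ, (weight m ξ * ‖hat (cutoff ε f) ξ‖ₑ) ^ 2
      ≤ ENNReal.ofReal (4 ^ m * (1 + d ^ m)) * ENNReal.ofReal (bandNormSq ε m f) := by
  rw [ofReal_bandNormSq, ← lintegral_const_mul' _ _ ENNReal.ofReal_ne_top]
  refine lintegral_mono fun ξ => ?_
  simp only
  rw [mul_pow, weight_sq, ← mul_assoc, ← ENNReal.ofReal_mul (by positivity)]
  gcongr
  exact one_add_norm_pow_le_sobolevWeight hd ξ

theorem sobolevWeightConst_nonneg (d m : ℕ) : 0 ≤ sobolevWeightConst d m :=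
  Finset.sum_nonneg fun _ _ => Finset.sum_nonneg fun _ _ => sq_nonneg _

theorem ofReal_bandNormSq_le {d : ℕ} (m : ℕ) (ε : ℝ) (f : L2 d) :
    ENNReal.ofReal (bandNormSq ε m f) ≤ ENNReal.ofReal (sobolevWeightConst d m) *
      ∫⁻ ξ, (weight m ξ * ‖hat f ξ‖ₑ) ^ 2 := by
  rw [ofReal_bandNormSq, ← lintegral_const_mul' _ _ ENNReal.ofReal_ne_top]
  refine lintegral_mono_ae ?_
  filter_upwards [hat_cutoff_ae ε f] with ξ h
  rw [h, mul_pow, weight_sq, ← mul_assoc,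
    ← ENNReal.ofReal_mul (sobolevWeightConst_nonneg d m)]
  gcongr
  · exact sobolevWeight_le ξ
  · exact enorm_indicator_le_enorm_self _ _

end Weight

/-! ### Products of band-limited functions -/

section Product

open scoped ENNReal

theorem integrable_hat_cutoff {d m : ℕ} (hd : 0 < d) (hm : d < m) (ε : ℝ) (f : L2 d) :
    Integrable (hat (cutoff ε f)) := by
  refine ⟨(Lp.memLp _).aestronglyMeasurable, ?_⟩
  have h := sq_lintegral_le_of_weight (μ := (volume : Measure (Space d))) (measurable_weight m)
    (Lp.stronglyMeasurable (hat (cutoff ε f))).measurable.enorm (weight_ne_zero m) (weight_ne_top m)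
  have h2 := h.trans_lt (ENNReal.mul_lt_top (lintegral_inv_weight_sq_lt_top hm)
    ((lintegral_weight_hat_cutoff_le hd ε f).trans_lt
      (ENNReal.mul_lt_top ENNReal.ofReal_lt_top ENNReal.ofReal_lt_top)))
  rw [hasFiniteIntegral_iff_enorm]
  by_contra hcon
  rw [not_lt, top_le_iff] at hcon
  rw [hcon] at h2
  exact absurd h2 (by simp)

theorem toComplex_ae_eq_fourierInv {d : ℕ} {f : L2 d} (h : Integrable (hat f)) :
    (fun x => (f x : ℂ)) =ᵐ[volume] (𝓕⁻ (hat f : Space d → ℂ) : Space d → ℂ) := by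
  have h1 := fourierInv_toLp_ae_eq h (Lp.memLp (hat f))
  rw [Lp.toLp_coeFn] at h1
  have h2 : 𝓕⁻ (hat f) = toComplex f := FourierTransform.fourierInv_fourier_eq (toComplex f)
  rw [h2] at h1
  exact (toComplex_ae f).symm.trans h1

theorem enorm_convolution_le {d : ℕ} (φ ψ : Space d → ℂ) (ξ : Space d) :
    ‖convolution φ ψ (ContinuousLinearMap.mul ℂ ℂ) volume ξ‖ₑ
      ≤ ((fun η => ‖φ η‖ₑ) ⋆ₗ (fun η => ‖ψ η‖ₑ)) ξ := by
  rw [lconvolution_def, convolution]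
  refine (enorm_integral_le_lintegral_enorm _).trans (le_of_eq (lintegral_congr fun η => ?_))
  simp [enorm_mul, sub_eq_neg_add]

theorem memLp_convolution {d : ℕ} {φ ψ : Space d → ℂ} (hφ : Integrable φ) (hψ : Integrable ψ)
    (hφm : Measurable φ) (hψm : Measurable ψ) (hψ2 : MemLp ψ 2) :
    MemLp (convolution φ ψ (ContinuousLinearMap.mul ℂ ℂ) volume) 2 := by
  refine ⟨(hφ.integrable_convolution _ hψ).aestronglyMeasurable, ?_⟩
  rw [eLpNorm_lt_top_iff_lintegral_rpow_enorm_lt_top (by norm_num) (by norm_num)]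
  simp only [ENNReal.toReal_ofNat, ENNReal.rpow_two]
  have h2 : ∫⁻ ξ, ‖ψ ξ‖ₑ ^ 2 < ∞ := by
    have := (eLpNorm_lt_top_iff_lintegral_rpow_enorm_lt_top (by norm_num) (by norm_num)).1 hψ2.2
    simpa only [ENNReal.toReal_ofNat, ENNReal.rpow_two] using this
  refine lt_of_le_of_lt ?_ (ENNReal.mul_lt_top (ENNReal.pow_lt_top (n := 2)
    (hasFiniteIntegral_iff_enorm.1 hφ.2)) h2)
  refine (lintegral_mono fun ξ => pow_le_pow_left₀ zero_le
    (enorm_convolution_le φ ψ ξ) 2).trans ?_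
  exact lintegral_sq_lconvolution_le hφm.enorm hψm.enorm

/-- The product of two functions with integrable Fourier transforms is square integrable, and its
Fourier transform is the convolution of the Fourier transforms. -/
theorem mul_of_integrable_hat {d : ℕ} {f g : L2 d} (hf : Integrable (hat f))
    (hg : Integrable (hat g)) :
    MemLp (fun x => f x * g x) 2 (volume : Measure (Space d)) ∧
    hat (mulL2 f g) =ᵐ[volume]
      convolution (hat f) (hat g) (ContinuousLinearMap.mul ℂ ℂ) volume := by
  have h1 := hf.integrable_convolution (ContinuousLinearMap.mul ℂ ℂ) hg
  have h2 := memLp_convolution hf hg (Lp.stronglyMeasurable _).measurable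
    (Lp.stronglyMeasurable _).measurable (Lp.memLp (hat g))
  have h3 : (fun x => ((f x * g x : ℝ) : ℂ)) =ᵐ[volume] (𝓕⁻ (h2.toLp _) : L2C d) := by
    filter_upwards [fourierInv_toLp_ae_eq h1 h2, toComplex_ae_eq_fourierInv hf,
      toComplex_ae_eq_fourierInv hg] with x e1 e2 e3
    rw [e1, Real.fourierInv_eq_fourier_neg, Real.fourier_mul_convolution_eq hf hg,
      ← Real.fourierInv_eq_fourier_neg, ← Real.fourierInv_eq_fourier_neg, ← e2, ← e3,
      Complex.ofReal_mul]
  have h4 : MemLp (fun x => f x * g x) 2 (volume : Measure (Space d)) := by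
    have := (Lp.memLp (𝓕⁻ (h2.toLp _) : L2C d)).ae_eq h3.symm
    simpa using this.re
  refine ⟨h4, ?_⟩
  have h5 : toComplex (mulL2 f g) = 𝓕⁻ (h2.toLp _) := by
    apply Lp.ext
    rw [mulL2, dif_pos h4]
    filter_upwards [toComplex_ae (h4.toLp _), h4.coeFn_toLp, h3] with x e1 e2 e3
    rw [e1, e2, e3]
  have h6 : hat (mulL2 f g) = h2.toLp _ := by
    rw [hat, h5]
    exact FourierTransform.fourier_fourierInv_eq _
  rw [h6]
  exact h2.coeFn_toLp

theorem mulL2_cutoff_ae {d m : ℕ} (hd : 0 < d) (hm : d < m) (ε : ℝ) (f g : L2 d) :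
    mulL2 (cutoff ε f) (cutoff ε g) =ᵐ[volume] fun x => cutoff ε f x * cutoff ε g x := by
  have h := (mul_of_integrable_hat (integrable_hat_cutoff hd hm ε f)
    (integrable_hat_cutoff hd hm ε g)).1
  rw [mulL2, dif_pos h]
  exact h.coeFn_toLp

/-- The algebra property of `H^m`, for band-limited functions and with a constant that does not
depend on the width of the band. -/
theorem exists_bandNormSq_mulL2_le {d m : ℕ} (hd : 0 < d) (hm : d < m) :
    ∃ C : ℝ, 0 ≤ C ∧ ∀ (ε : ℝ) (f g : L2 d),
      bandNormSq ε m (mulL2 (cutoff ε f) (cutoff ε g))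
        ≤ C * bandNormSq ε m f * bandNormSq ε m g := by
  set I := ∫⁻ ξ : Space d, (weight m ξ)⁻¹ ^ 2 with hI
  have hItop : I ≠ ∞ := (lintegral_inv_weight_sq_lt_top hm).ne
  set C₁ : ℝ := 4 ^ m * (1 + d ^ m) with hC₁
  set K : ℝ≥0∞ := ENNReal.ofReal (sobolevWeightConst d m) * (4 * (2 ^ m) ^ 2 * I) *
    ENNReal.ofReal C₁ * ENNReal.ofReal C₁ with hK
  have hKtop : K ≠ ∞ := by
    refine ENNReal.mul_ne_top (ENNReal.mul_ne_top (ENNReal.mul_ne_top ENNReal.ofReal_ne_top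
      (ENNReal.mul_ne_top (ENNReal.mul_ne_top (by norm_num) ?_) hItop)) ENNReal.ofReal_ne_top)
      ENNReal.ofReal_ne_top
    exact ENNReal.pow_ne_top (ENNReal.pow_ne_top (by norm_num))
  refine ⟨K.toReal, ENNReal.toReal_nonneg, fun ε f g => ?_⟩
  set φ := hat (cutoff ε f)
  set ψ := hat (cutoff ε g)
  have hφm : Measurable (fun ξ => ‖φ ξ‖ₑ) := (Lp.stronglyMeasurable φ).measurable.enorm
  have hψm : Measurable (fun ξ => ‖ψ ξ‖ₑ) := (Lp.stronglyMeasurable ψ).measurable.enorm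
  have hprod := (mul_of_integrable_hat (integrable_hat_cutoff hd hm ε f)
    (integrable_hat_cutoff hd hm ε g)).2
  have h1 : ∫⁻ ξ, (weight m ξ * ‖hat (mulL2 (cutoff ε f) (cutoff ε g)) ξ‖ₑ) ^ 2
      ≤ ∫⁻ ξ, (weight m ξ * ((fun η => ‖φ η‖ₑ) ⋆ₗ (fun η => ‖ψ η‖ₑ)) ξ) ^ 2 := by
    refine lintegral_mono_ae ?_
    filter_upwards [hprod] with ξ h
    rw [h]
    gcongr
    exact enorm_convolution_le _ _ ξ
  have h2 := lintegral_sq_weight_mul_lconvolution_le (μ := (volume : Measure (Space d)))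
    (measurable_weight m) hφm hψm (weight_ne_zero m) (weight_ne_top m) (weight_le m)
  have h3 : ENNReal.ofReal (bandNormSq ε m (mulL2 (cutoff ε f) (cutoff ε g)))
      ≤ K * ENNReal.ofReal (bandNormSq ε m f) * ENNReal.ofReal (bandNormSq ε m g) := by
    calc ENNReal.ofReal (bandNormSq ε m (mulL2 (cutoff ε f) (cutoff ε g)))
        ≤ ENNReal.ofReal (sobolevWeightConst d m) * (4 * (2 ^ m) ^ 2 * I *
          (ENNReal.ofReal C₁ * ENNReal.ofReal (bandNormSq ε m f)) *
          (ENNReal.ofReal C₁ * ENNReal.ofReal (bandNormSq ε m g))) := by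
          refine (ofReal_bandNormSq_le m ε _).trans ?_
          gcongr
          refine (h1.trans h2).trans ?_
          gcongr
          · exact lintegral_weight_hat_cutoff_le hd ε f
          · exact lintegral_weight_hat_cutoff_le hd ε g
      _ = _ := by rw [hK]; ring
  rw [← ENNReal.ofReal_toReal hKtop, ← ENNReal.ofReal_mul ENNReal.toReal_nonneg,
    ← ENNReal.ofReal_mul (mul_nonneg ENNReal.toReal_nonneg (bandNormSq_nonneg _ _ _))] at h3
  exact (ENNReal.ofReal_le_ofReal_iff (mul_nonneg (mul_nonneg ENNReal.toReal_nonneg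
    (bandNormSq_nonneg _ _ _)) (bandNormSq_nonneg _ _ _))).1 h3

end Product

/-! ### Maps that are Lipschitz on balls -/

section LipschitzOnBalls

open scoped NNReal

variable {E G G' : Type*} [NormedAddCommGroup E] [NormedAddCommGroup G] [NormedAddCommGroup G']

theorem LipschitzOnBalls.add {F F' : E → G} (h : LipschitzOnBalls F) (h' : LipschitzOnBalls F') :
    LipschitzOnBalls fun x => F x + F' x := by
  intro R
  obtain ⟨K, hK⟩ := h R
  obtain ⟨K', hK'⟩ := h' R
  exact ⟨K + K', hK.add hK'⟩

theorem LipschitzOnBalls.sub {F F' : E → G} (h : LipschitzOnBalls F) (h' : LipschitzOnBalls F') :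
    LipschitzOnBalls fun x => F x - F' x := by
  intro R
  obtain ⟨K, hK⟩ := h R
  obtain ⟨K', hK'⟩ := h' R
  exact ⟨K + K', hK.sub hK'⟩

theorem LipschitzOnBalls.pi {ι : Type*} [Fintype ι] {F : E → ι → G}
    (h : ∀ i, LipschitzOnBalls fun x => F x i) : LipschitzOnBalls F := by
  intro R
  choose K hK using fun i => h i R
  refine ⟨∑ i, K i, LipschitzOnWith.of_dist_le_mul fun x hx y hy => ?_⟩
  refine (dist_pi_le_iff (by positivity)).2 fun i => ((hK i).dist_le_mul x hx y hy).trans ?_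
  gcongr
  exact Finset.single_le_sum (f := K) (fun _ _ => zero_le) (Finset.mem_univ i)

theorem LipschitzOnBalls.sum {ι : Type*} (s : Finset ι) {F : ι → E → G}
    (h : ∀ i ∈ s, LipschitzOnBalls (F i)) : LipschitzOnBalls fun x => ∑ i ∈ s, F i x := by
  classical
  induction s using Finset.induction_on with
  | empty => exact fun _ => ⟨0, by simp [LipschitzOnWith]⟩
  | insert a s ha ih =>
    simp only [Finset.sum_insert ha]
    exact (h a (Finset.mem_insert_self a s)).add
      (ih fun i hi => h i (Finset.mem_insert_of_mem hi))

theorem LipschitzOnBalls.continuous {F : E → G} (h : LipschitzOnBalls F) : Continuous F := by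
  refine continuous_iff_continuousAt.2 fun x => ?_
  obtain ⟨K, hK⟩ := h (‖x‖ + 1)
  refine hK.continuousOn.continuousAt (Filter.mem_of_superset
    (Metric.isOpen_ball.mem_nhds (x := x) (s := Metric.ball 0 (‖x‖ + 1)) ?_)
    Metric.ball_subset_closedBall)
  simp

variable [NormedSpace ℝ G] [NormedSpace ℝ G']

theorem LipschitzOnBalls.clm_comp {F : E → G} (h : LipschitzOnBalls F) (L : G →L[ℝ] G') :
    LipschitzOnBalls fun x => L (F x) := by
  intro R
  obtain ⟨K, hK⟩ := h R
  exact ⟨‖L‖₊ * K, L.lipschitz.comp_lipschitzOnWith hK⟩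

theorem LipschitzOnBalls.const_smul {F : E → G} (h : LipschitzOnBalls F) (c : ℝ) :
    LipschitzOnBalls fun x => c • F x :=
  h.clm_comp (c • ContinuousLinearMap.id ℝ G)

variable [NormedSpace ℝ E]

theorem lipschitzOnBalls_clm (L : E →L[ℝ] G) : LipschitzOnBalls L :=
  fun _ => ⟨‖L‖₊, L.lipschitz.lipschitzOnWith⟩

/-- A quadratic map is Lipschitz on balls. -/
theorem lipschitzOnBalls_bilinear (B : G →L[ℝ] G →L[ℝ] G') (L L' : E →L[ℝ] G) :
    LipschitzOnBalls fun x => B (L x) (L' x) := by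
  intro R
  refine ⟨‖B‖₊ * ‖L‖₊ * ‖L'‖₊ * (2 * Real.toNNReal R), LipschitzOnWith.of_dist_le_mul
    fun x hx y hy => ?_⟩
  rw [mem_closedBall_zero_iff] at hx hy
  have hR : 0 ≤ R := (norm_nonneg x).trans hx
  have e : B (L x) (L' x) - B (L y) (L' y) = B (L x) (L' (x - y)) + B (L (x - y)) (L' y) := by
    simp only [map_sub, sub_apply]
    abel
  rw [dist_eq_norm, dist_eq_norm, e]
  have h1 : ‖B (L x) (L' (x - y))‖ ≤ ‖B‖ * (‖L‖ * R) * (‖L'‖ * ‖x - y‖) :=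
    (B.le_opNorm₂ _ _).trans (by
      gcongr
      · exact (L.le_opNorm x).trans (by gcongr)
      · exact L'.le_opNorm _)
  have h2 : ‖B (L (x - y)) (L' y)‖ ≤ ‖B‖ * (‖L‖ * ‖x - y‖) * (‖L'‖ * R) :=
    (B.le_opNorm₂ _ _).trans (by
      gcongr
      · exact L.le_opNorm _
      · exact (L'.le_opNorm y).trans (by gcongr))
  refine (norm_add_le _ _).trans ((add_le_add h1 h2).trans (le_of_eq ?_))
  push_cast
  rw [Real.coe_toNNReal R hR]
  ring

end LipschitzOnBalls

/-! ### The vector field of the truncated equation -/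

theorem exists_bandNormSq_le {d : ℕ} (ε : ℝ) (m : ℕ) :
    ∃ M : ℝ, 0 ≤ M ∧ ∀ f : L2 d, bandNormSq ε m f ≤ M * ‖f‖ ^ 2 := by
  refine ⟨∑ k ∈ Finset.range (m + 1), ∑ τ ∈ Finset.piAntidiag (Finset.univ : Finset (Fin d)) k,
    ‖truncDeriv ε τ‖ ^ 2, Finset.sum_nonneg fun _ _ => Finset.sum_nonneg fun _ _ => sq_nonneg _,
    fun f => ?_⟩
  rw [bandNormSq, Finset.sum_mul]
  refine Finset.sum_le_sum fun k _ => ?_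
  rw [Finset.sum_mul]
  refine Finset.sum_le_sum fun τ _ => ?_
  rw [← mul_pow]
  exact pow_le_pow_left₀ (norm_nonneg _) ((truncDeriv ε τ).le_opNorm f) 2

/-- `(f, g) ↦ Λ_ε (Λ_ε f · Λ_ε g)` is a bounded bilinear map on `L²`. -/
theorem exists_bilinear_cutoff_mulL2 {d : ℕ} (hd : 0 < d) (ε : ℝ) :
    ∃ B : L2 d →L[ℝ] L2 d →L[ℝ] L2 d,
      ∀ f g, B f g = cutoff ε (mulL2 (cutoff ε f) (cutoff ε g)) := by
  -- The bound in `L²` goes through the algebra property of `H^{d+1}`.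
  have hm : d < d + 1 := Nat.lt_succ_self d
  obtain ⟨C, hC, hbound⟩ := exists_bandNormSq_mulL2_le hd hm
  obtain ⟨M, hM, hband⟩ := exists_bandNormSq_le (d := d) ε (d + 1)
  have hadd : ∀ f g : L2 d, cutoff ε (f + g) = cutoff ε f + cutoff ε g := fun f g => by
    simp only [cutoff_eq_truncDeriv, map_add]
  have hsmul : ∀ (c : ℝ) (f : L2 d), cutoff ε (c • f) = c • cutoff ε f := fun c f => by
    simp only [cutoff_eq_truncDeriv, map_smul]
  have hmul := mulL2_cutoff_ae hd hm ε
  let B₀ : L2 d →ₗ[ℝ] L2 d →ₗ[ℝ] L2 d := LinearMap.mk₂ ℝ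
    (fun f g => cutoff ε (mulL2 (cutoff ε f) (cutoff ε g)))
    (fun f f' g => by
      rw [← hadd]
      congr 1
      apply Lp.ext
      filter_upwards [hmul (f + f') g, hmul f g, hmul f' g, Lp.coeFn_add (cutoff ε f) (cutoff ε f'),
        Lp.coeFn_add (mulL2 (cutoff ε f) (cutoff ε g)) (mulL2 (cutoff ε f') (cutoff ε g))]
        with x h1 h2 h3 h4 h5
      rw [h1, h5, Pi.add_apply, h2, h3, hadd, h4, Pi.add_apply, add_mul])
    (fun c f g => by
      rw [← hsmul]
      congr 1
      apply Lp.ext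
      filter_upwards [hmul (c • f) g, hmul f g, Lp.coeFn_smul c (cutoff ε f),
        Lp.coeFn_smul c (mulL2 (cutoff ε f) (cutoff ε g))] with x h1 h2 h3 h4
      rw [h1, h4, Pi.smul_apply, h2, hsmul, h3, Pi.smul_apply, smul_eq_mul, smul_eq_mul, mul_assoc])
    (fun f g g' => by
      rw [← hadd]
      congr 1
      apply Lp.ext
      filter_upwards [hmul f (g + g'), hmul f g, hmul f g', Lp.coeFn_add (cutoff ε g) (cutoff ε g'),
        Lp.coeFn_add (mulL2 (cutoff ε f) (cutoff ε g)) (mulL2 (cutoff ε f) (cutoff ε g'))]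
        with x h1 h2 h3 h4 h5
      rw [h1, h5, Pi.add_apply, h2, h3, hadd, h4, Pi.add_apply, mul_add])
    (fun c f g => by
      rw [← hsmul]
      congr 1
      apply Lp.ext
      filter_upwards [hmul f (c • g), hmul f g, Lp.coeFn_smul c (cutoff ε g),
        Lp.coeFn_smul c (mulL2 (cutoff ε f) (cutoff ε g))] with x h1 h2 h3 h4
      rw [h1, h4, Pi.smul_apply, h2, hsmul, h3, Pi.smul_apply, smul_eq_mul, smul_eq_mul,
        mul_left_comm])
  refine ⟨B₀.mkContinuous₂ (Real.sqrt C * M) fun f g => ?_, fun f g => rfl⟩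
  refine abs_le_of_sq_le_sq' ?_ (by positivity) |>.2
  calc ‖B₀ f g‖ ^ 2 ≤ bandNormSq ε (d + 1) (mulL2 (cutoff ε f) (cutoff ε g)) :=
        norm_sq_cutoff_le_bandNormSq ε (d + 1) _
    _ ≤ C * bandNormSq ε (d + 1) f * bandNormSq ε (d + 1) g := hbound ε f g
    _ ≤ C * (M * ‖f‖ ^ 2) * (M * ‖g‖ ^ 2) := by
        gcongr
        · exact bandNormSq_nonneg _ _ _
        · exact hband f
        · exact hband g
    _ = (Real.sqrt C * M * ‖f‖ * ‖g‖) ^ 2 := by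
        rw [mul_pow, mul_pow, mul_pow, Real.sq_sqrt hC]
        ring

section VectorField

variable {d n : ℕ} (ε ν : ℝ) (v : Fin (n + 1) → Space d) (w : Fin (n + 1) → ℝ) (cs : ℝ)

/-- The momentum `u_a = ∑_i w_i v_{i,a} g_i`. -/
noncomputable def momentum (a : Fin d) : State d n →L[ℝ] L2 d :=
  ∑ i, (w i * v i a) • ContinuousLinearMap.proj (R := ℝ) (φ := fun _ : Fin (n + 1) => L2 d) i

theorem momentum_apply (a : Fin d) (g : State d n) :
    momentum v w a g = ∑ i, (w i * v i a) • g i := by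
  simp [momentum]

theorem cutoffVelocity_eq (a : Fin d) (g : State d n) :
    cutoffVelocity ε v w g a = cutoff ε (momentum v w a g) := by
  simp only [cutoffVelocity, momentum_apply, cutoff_eq_truncDeriv, map_sum, map_smul]

theorem lipschitzOnBalls_cutoff_component (i : Fin (n + 1)) :
    LipschitzOnBalls fun x : State d n => cutoff ε (x i) := by
  simp only [cutoff_eq_truncDeriv]
  exact lipschitzOnBalls_clm ((truncDeriv ε 0).comp
    (ContinuousLinearMap.proj (R := ℝ) (φ := fun _ : Fin (n + 1) => L2 d) i))

theorem lipschitzOnBalls_equilibrium (hd : 0 < d) :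
    LipschitzOnBalls (equilibrium ε v w cs : State d n → State d n) := by
  obtain ⟨B, hB⟩ := exists_bilinear_cutoff_mulL2 hd ε
  refine LipschitzOnBalls.pi fun i => ?_
  simp only [equilibrium, cutoffDensity]
  refine LipschitzOnBalls.add (LipschitzOnBalls.add ?_ ?_) ?_
  · exact LipschitzOnBalls.sum _ fun i _ => (lipschitzOnBalls_cutoff_component ε i).const_smul _
  · refine LipschitzOnBalls.const_smul (LipschitzOnBalls.sum _ fun a _ => ?_) _
    refine LipschitzOnBalls.const_smul (LipschitzOnBalls.sum _ fun i _ => ?_) _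
    exact (lipschitzOnBalls_cutoff_component ε i).const_smul _
  · refine LipschitzOnBalls.const_smul (LipschitzOnBalls.sum _ fun a _ => ?_) _
    refine LipschitzOnBalls.sum _ fun b _ => LipschitzOnBalls.const_smul ?_ _
    simp only [cutoffVelocity_eq, ← hB]
    exact lipschitzOnBalls_bilinear B (momentum v w a) (momentum v w b)

theorem transport_stateCutoff (g : State d n) (i : Fin (n + 1)) :
    transport v (stateCutoff ε g) i = ∑ a, v i a • truncDeriv ε (Pi.single a 1) (g i) := by
  simp only [transport, stateCutoff, weakDeriv_cutoff]

theorem lipschitzOnBalls_rhs (hd : 0 < d) :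
    LipschitzOnBalls (rhs ε ν v w cs : State d n → State d n) := by
  have h1 : LipschitzOnBalls (stateCutoff ε : State d n → State d n) :=
    LipschitzOnBalls.pi (lipschitzOnBalls_cutoff_component ε)
  have h2 : LipschitzOnBalls fun g : State d n => transport v (stateCutoff ε g) := by
    refine LipschitzOnBalls.pi fun i => ?_
    simp only [transport_stateCutoff]
    refine LipschitzOnBalls.sum _ fun a _ => LipschitzOnBalls.const_smul ?_ _
    exact lipschitzOnBalls_clm ((truncDeriv ε (Pi.single a 1)).comp
      (ContinuousLinearMap.proj (R := ℝ) (φ := fun _ : Fin (n + 1) => L2 d) i))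
  exact (((lipschitzOnBalls_equilibrium ε v w cs hd).sub h1).const_smul _).sub h2

theorem cutoff_cutoff (f : L2 d) : cutoff ε (cutoff ε f) = cutoff ε f := by
  rw [cutoff_eq_truncDeriv, cutoff_eq_truncDeriv, truncDeriv_truncDeriv, zero_add]

/-- `Λ_ε` on vectors of functions, as a bounded operator. -/
noncomputable def stateCutoffCLM : State d n →L[ℝ] State d n :=
  ContinuousLinearMap.pi fun i => (truncDeriv ε 0).comp (ContinuousLinearMap.proj i)

theorem stateCutoffCLM_apply (g : State d n) : stateCutoffCLM ε g = stateCutoff ε g := by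
  ext1 i
  simp [stateCutoffCLM, stateCutoff, cutoff_eq_truncDeriv]

theorem stateCutoff_stateCutoff (g : State d n) :
    stateCutoff ε (stateCutoff ε g) = stateCutoff ε g :=
  funext fun i => cutoff_cutoff ε (g i)

theorem equilibrium_stateCutoff (g : State d n) :
    equilibrium ε v w cs (stateCutoff ε g) = equilibrium ε v w cs g := by
  have h1 : cutoffVelocity ε v w (stateCutoff ε g) = cutoffVelocity ε v w g := by
    funext a
    simp only [cutoffVelocity, stateCutoff, cutoff_cutoff]
  have h2 : cutoffDensity ε w (stateCutoff ε g) = cutoffDensity ε w g := by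
    simp only [cutoffDensity, stateCutoff, cutoff_cutoff]
  funext i
  simp only [equilibrium, h1, h2]

theorem rhs_stateCutoff (g : State d n) :
    rhs ε ν v w cs (stateCutoff ε g) = rhs ε ν v w cs g := by
  rw [rhs, rhs, equilibrium_stateCutoff, stateCutoff_stateCutoff]

theorem stateCutoff_equilibrium (g : State d n) :
    stateCutoff ε (equilibrium ε v w cs g) = equilibrium ε v w cs g := by
  funext i
  simp only [stateCutoff, equilibrium, cutoffDensity, cutoffVelocity, cutoff_eq_truncDeriv, map_add,
    map_smul, map_sum, truncDeriv_truncDeriv, add_zero]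

theorem stateCutoff_rhs (g : State d n) :
    stateCutoff ε (rhs ε ν v w cs g) = rhs ε ν v w cs g := by
  have h : stateCutoff ε (transport v (stateCutoff ε g)) = transport v (stateCutoff ε g) := by
    funext i
    rw [stateCutoff, transport_stateCutoff]
    simp only [cutoff_eq_truncDeriv, map_sum, map_smul, truncDeriv_truncDeriv, zero_add]
  rw [rhs, ← stateCutoffCLM_apply, map_sub, map_smul, map_sub]
  simp only [stateCutoffCLM_apply, stateCutoff_equilibrium, stateCutoff_stateCutoff, h]

/-- The vector field `ε⁻¹ rhs`, of which band-limited solutions are integral curves. -/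
noncomputable def field (g : State d n) : State d n := ε⁻¹ • rhs ε ν v w cs g

theorem lipschitzOnBalls_field (hd : 0 < d) :
    LipschitzOnBalls (field ε ν v w cs : State d n → State d n) :=
  (lipschitzOnBalls_rhs ε ν v w cs hd).const_smul _

theorem stateCutoff_field (g : State d n) :
    stateCutoff ε (field ε ν v w cs g) = field ε ν v w cs g := by
  rw [field, ← stateCutoffCLM_apply, map_smul, stateCutoffCLM_apply, stateCutoff_rhs]

/-! ### Sobolev norms of vectors of band-limited functions -/

theorem stateNormSq_stateCutoff (m : ℕ) (g : State d n) :
    stateNormSq m w (stateCutoff ε g) = ∑ i, w i * bandNormSq ε m (g i) := by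
  simp only [stateNormSq, stateCutoff, sobolevNormSq_cutoff]

variable {w}

theorem stateNormSq_nonneg (hw : ∀ i, 0 < w i) (m : ℕ) (g : State d n) :
    0 ≤ stateNormSq m w g :=
  Finset.sum_nonneg fun i _ => mul_nonneg (hw i).le
    (Finset.sum_nonneg fun _ _ => Finset.sum_nonneg fun _ _ => sq_nonneg _)

theorem exists_stateNormSq_stateCutoff_le (hw : ∀ i, 0 < w i) (m : ℕ) :
    ∃ M : ℝ, 0 ≤ M ∧ ∀ g : State d n, stateNormSq m w (stateCutoff ε g) ≤ M * ‖g‖ ^ 2 := by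
  obtain ⟨M, hM, h⟩ := exists_bandNormSq_le (d := d) ε m
  refine ⟨∑ i, w i * M, Finset.sum_nonneg fun i _ => mul_nonneg (hw i).le hM, fun g => ?_⟩
  rw [stateNormSq_stateCutoff, Finset.sum_mul]
  refine Finset.sum_le_sum fun i _ => ?_
  rw [mul_assoc]
  refine mul_le_mul_of_nonneg_left ((h (g i)).trans ?_) (hw i).le
  gcongr
  exact norm_le_pi_norm g i

theorem exists_norm_stateCutoff_sq_le (hw : ∀ i, 0 < w i) (m : ℕ) :
    ∃ c : ℝ, 0 < c ∧
      ∀ g : State d n, ‖stateCutoff ε g‖ ^ 2 ≤ c * stateNormSq m w (stateCutoff ε g) := by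
  refine ⟨∑ i, (w i)⁻¹, Finset.sum_pos (fun i _ => inv_pos.2 (hw i)) Finset.univ_nonempty,
    fun g => ?_⟩
  set N := stateNormSq m w (stateCutoff ε g) with hN
  have hN0 : 0 ≤ N := stateNormSq_nonneg hw m _
  have hc : 0 ≤ ∑ i, (w i)⁻¹ := Finset.sum_nonneg fun i _ => (inv_pos.2 (hw i)).le
  have h1 : ∀ i, ‖stateCutoff ε g i‖ ≤ Real.sqrt ((∑ i, (w i)⁻¹) * N) := by
    intro i
    refine Real.le_sqrt_of_sq_le ?_
    have h2 : w i * bandNormSq ε m (g i) ≤ N := by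
      rw [hN, stateNormSq_stateCutoff]
      exact Finset.single_le_sum (f := fun i => w i * bandNormSq ε m (g i))
        (fun j _ => mul_nonneg (hw j).le (bandNormSq_nonneg _ _ _)) (Finset.mem_univ i)
    calc ‖stateCutoff ε g i‖ ^ 2 ≤ bandNormSq ε m (g i) := norm_sq_cutoff_le_bandNormSq ε m (g i)
      _ = (w i)⁻¹ * (w i * bandNormSq ε m (g i)) := by
          rw [← mul_assoc, inv_mul_cancel₀ (hw i).ne', one_mul]
      _ ≤ (w i)⁻¹ * N := mul_le_mul_of_nonneg_left h2 (inv_pos.2 (hw i)).le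
      _ ≤ (∑ i, (w i)⁻¹) * N := by
          gcongr
          exact Finset.single_le_sum (f := fun i => (w i)⁻¹)
            (fun j _ => (inv_pos.2 (hw j)).le) (Finset.mem_univ i)
  have h3 := (pi_norm_le_iff_of_nonneg (Real.sqrt_nonneg _)).2 h1
  calc ‖stateCutoff ε g‖ ^ 2 ≤ Real.sqrt ((∑ i, (w i)⁻¹) * N) ^ 2 :=
        pow_le_pow_left₀ (norm_nonneg _) h3 2
    _ = (∑ i, (w i)⁻¹) * N := Real.sq_sqrt (mul_nonneg hc hN0)

end VectorField

/-! ### Solutions are integral curves -/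

section Curve

variable {d n m : ℕ} {ε ν : ℝ} {v : Fin (n + 1) → Space d} {w : Fin (n + 1) → ℝ} {cs T : ℝ}
  {g0 : State d n}

/-- If `g` solves the equation, then `Λ_ε g` is an integral curve of `field`. -/
theorem isIntegralCurveOn_of_isSolution (hd : 0 < d) (hε : ε ≠ 0) (hT : 0 ≤ T)
    {g : ℝ → State d n} (h : IsSolution m ε ν v w cs T g0 g) :
    stateCutoff ε (g 0) = stateCutoff ε g0 ∧
      IsIntegralCurveOn (fun t => stateCutoff ε (g t)) (fun _ => field ε ν v w cs) (Icc 0 T) := by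
  set x : ℝ → State d n := fun t => stateCutoff ε (g t) with hxdef
  have hfield : ∀ s, field ε ν v w cs (x s) = ε⁻¹ • rhs ε ν v w cs (g s) := fun s => by
    rw [field, hxdef, rhs_stateCutoff]
  have hx : ∀ t ∈ Icc 0 T,
      x t = stateCutoff ε g0 + ε⁻¹ • ∫ s in (0 : ℝ)..t, rhs ε ν v w cs (g s) := by
    intro t ht
    have := congrArg (fun z => ε⁻¹ • z) (h.equation t ht)
    simpa only [smul_add, smul_smul, inv_mul_cancel₀ hε, one_smul] using this
  have hcont : ContinuousOn x (Icc 0 T) := by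
    have h1 : ContinuousOn (fun t => ∫ s in (0 : ℝ)..t, rhs ε ν v w cs (g s)) (uIcc 0 T) :=
      intervalIntegral.continuousOn_primitive_interval ((intervalIntegrable_iff').1 h.integrable)
    rw [uIcc_of_le hT] at h1
    exact (continuousOn_const.add (h1.const_smul ε⁻¹)).congr hx
  have hpicard : ∀ t ∈ Icc 0 T,
      x t = ODE.picard (fun _ => field ε ν v w cs) 0 (stateCutoff ε g0) x t := by
    intro t ht
    rw [ODE.picard_apply, hx t ht, ← intervalIntegral.integral_smul]
    simp only [hfield]
  refine ⟨?_, fun t ht => ?_⟩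
  · simpa using hx 0 ⟨le_rfl, hT⟩
  · have hF := (lipschitzOnBalls_field ε ν v w cs hd).continuous
    exact (ODE.hasDerivWithinAt_picard_Icc (f := fun _ => field ε ν v w cs) (u := univ) ⟨le_rfl, hT⟩
      (hF.comp continuous_snd).continuousOn hcont (fun _ _ => mem_univ _) (stateCutoff ε g0) ht).congr
        hpicard (hpicard t ht)

theorem eq_add_integral_of_isIntegralCurveOn (hd : 0 < d) {x : ℝ → State d n}
    (hx : IsIntegralCurveOn x (fun _ => field ε ν v w cs) (Icc 0 T)) {t : ℝ} (ht : t ∈ Icc 0 T) :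
    x t = x 0 + ∫ s in (0 : ℝ)..t, field ε ν v w cs (x s) := by
  have hF := (lipschitzOnBalls_field ε ν v w cs hd).continuous
  have := ODE.picard_eq_of_hasDerivAt (f := fun _ => field ε ν v w cs) (t₀ := 0) (t := t) (α := x)
    (u := univ) (hF.comp continuous_snd).continuousOn
    (fun s hs => by
      rw [uIcc_of_le ht.1] at hs ⊢
      exact (hx s ⟨hs.1, hs.2.trans ht.2⟩).mono (Icc_subset_Icc_right ht.2))
    (mapsTo_univ _ _)
  exact this.symm

theorem intervalIntegrable_field (hd : 0 < d) {x : ℝ → State d n}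
    (hx : IsIntegralCurveOn x (fun _ => field ε ν v w cs) (Icc 0 T)) {t : ℝ} (ht : t ∈ Icc 0 T) :
    IntervalIntegrable (fun s => field ε ν v w cs (x s)) volume 0 t := by
  refine ContinuousOn.intervalIntegrable ?_
  rw [uIcc_of_le ht.1]
  exact (lipschitzOnBalls_field ε ν v w cs hd).continuous.comp_continuousOn
    ((IsIntegralCurveOn.continuousOn_Icc hx).mono (Icc_subset_Icc_right ht.2))

/-- The range of `Λ_ε` is invariant under the flow of `field`. -/
theorem stateCutoff_eq_of_isIntegralCurveOn (hd : 0 < d) {x : ℝ → State d n}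
    (hx : IsIntegralCurveOn x (fun _ => field ε ν v w cs) (Icc 0 T)) (hx0 : x 0 = stateCutoff ε g0)
    {t : ℝ} (ht : t ∈ Icc 0 T) : stateCutoff ε (x t) = x t := by
  rw [eq_add_integral_of_isIntegralCurveOn hd hx ht, hx0, ← stateCutoffCLM_apply, map_add,
    ← ContinuousLinearMap.intervalIntegral_comp_comm _ (intervalIntegrable_field hd hx ht)]
  simp only [stateCutoffCLM_apply, stateCutoff_field, stateCutoff_stateCutoff]

theorem isBandLimitedSolution_of_isIntegralCurveOn (hd : 0 < d) (hε : ε ≠ 0) (hT : 0 ≤ T)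
    (hw : ∀ i, 0 < w i) {x : ℝ → State d n}
    (hx : IsIntegralCurveOn x (fun _ => field ε ν v w cs) (Icc 0 T))
    (hx0 : x 0 = stateCutoff ε g0) : IsBandLimitedSolution m ε ν v w cs T g0 x := by
  have hband : ∀ t ∈ Icc 0 T, stateCutoff ε (x t) = x t := fun t ht =>
    stateCutoff_eq_of_isIntegralCurveOn hd hx hx0 ht
  have hrhs : ∀ s, rhs ε ν v w cs (x s) = ε • field ε ν v w cs (x s) := fun s => by
    rw [field, smul_smul, mul_inv_cancel₀ hε, one_smul]
  refine ⟨⟨fun t ht i => ?_, ?_, ?_, ?_, fun t ht => ?_⟩, fun t ht => (hband t ht).symm⟩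
  · rw [← hband t ht]
    exact memH_cutoff m ε _
  · obtain ⟨R, hR, hbd⟩ := exists_norm_le_of_isIntegralCurveOn hx
    obtain ⟨M, hM, hnorm⟩ := exists_stateNormSq_stateCutoff_le (d := d) ε hw m
    refine ⟨M * R ^ 2, fun t ht => ?_⟩
    rw [← hband t ht]
    refine (hnorm (x t)).trans ?_
    gcongr
    exact hbd t ht
  · exact (IsIntegralCurveOn.continuousOn_Icc hx).aestronglyMeasurable measurableSet_Icc
  · simp only [hrhs]
    exact (intervalIntegrable_field hd hx ⟨hT, le_rfl⟩).smul ε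
  · rw [hband t ht, eq_add_integral_of_isIntegralCurveOn hd hx ht, hx0]
    simp only [hrhs]
    rw [intervalIntegral.integral_smul, smul_add]

end Curve

/-! ### Moments of the lattice and the collision operator -/

section Collision

variable {d n : ℕ} {v : Fin (n + 1) → Space d} {w : Fin (n + 1) → ℝ} {cs : ℝ}
  {H : Type*} [NormedAddCommGroup H] [InnerProductSpace ℝ H]

theorem IsIsotropicLattice.weight_le_one (hL : IsIsotropicLattice v w cs) (i : Fin (n + 1)) :
    w i ≤ 1 := by
  rw [← hL.moment_zero]
  exact Finset.single_le_sum (f := w) (fun j _ => (hL.w_pos j).le) (Finset.mem_univ i)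

/-- The coefficients `v_{i,a} v_{i,b} - cs² δ_{ab}` of the quadratic part of the equilibrium. -/
noncomputable def stressCoeff (v : Fin (n + 1) → Space d) (cs : ℝ) (i : Fin (n + 1)) (a b : Fin d) :
    ℝ :=
  v i a * v i b - cs ^ 2 * (if a = b then 1 else 0)

theorem IsIsotropicLattice.sum_stressCoeff (hL : IsIsotropicLattice v w cs) (a b : Fin d) :
    ∑ i, w i * stressCoeff v cs i a b = 0 := by
  have e : ∀ i, w i * stressCoeff v cs i a b
      = w i * v i a * v i b - w i * (cs ^ 2 * (if a = b then 1 else 0)) := fun i => by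
    rw [stressCoeff]; ring
  rw [Finset.sum_congr rfl fun i _ => e i, Finset.sum_sub_distrib, ← Finset.sum_mul,
    hL.moment_two, hL.moment_zero]
  ring

theorem IsIsotropicLattice.sum_velocity_stressCoeff (hL : IsIsotropicLattice v w cs)
    (a b c : Fin d) : ∑ i, (w i * v i c) * stressCoeff v cs i a b = 0 := by
  have e : ∀ i, (w i * v i c) * stressCoeff v cs i a b
      = w i * v i c * v i a * v i b - w i * v i c * (cs ^ 2 * (if a = b then 1 else 0)) :=
    fun i => by rw [stressCoeff]; ring
  rw [Finset.sum_congr rfl fun i _ => e i, Finset.sum_sub_distrib, ← Finset.sum_mul,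
    hL.moment_three, hL.moment_one]
  ring

/-- The linear part `ρ + v_i · u / cs²` of the equilibrium. -/
noncomputable def linearEquilibrium (v : Fin (n + 1) → Space d) (w : Fin (n + 1) → ℝ) (cs : ℝ)
    (X : Fin (n + 1) → H) (i : Fin (n + 1)) : H :=
  ∑ j, w j • X j + (1 / cs ^ 2) • ∑ a, v i a • ∑ j, (w j * v j a) • X j

/-- The quadratic part of the equilibrium, with the products `u_a u_b` replaced by `N a b`. -/
noncomputable def quadraticEquilibrium (v : Fin (n + 1) → Space d) (cs κ : ℝ)
    (N : Fin d → Fin d → H) (i : Fin (n + 1)) : H :=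
  κ • ∑ a, ∑ b, stressCoeff v cs i a b • N a b

theorem sum_smul_sum_smul {ι ι' : Type*} [Fintype ι] [Fintype ι'] (μ : ι → ℝ) (c : ι → ι' → ℝ)
    (Y : ι' → H) : ∑ i, μ i • ∑ a, c i a • Y a = ∑ a, (∑ i, μ i * c i a) • Y a := by
  simp only [Finset.smul_sum, Finset.sum_smul, smul_smul]
  exact Finset.sum_comm

theorem sum_smul_quadraticEquilibrium (μ : Fin (n + 1) → ℝ) (κ : ℝ) (N : Fin d → Fin d → H)
    (hμ : ∀ a b, ∑ i, μ i * stressCoeff v cs i a b = 0) :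
    ∑ i, μ i • quadraticEquilibrium v cs κ N i = 0 := by
  simp only [quadraticEquilibrium, smul_comm _ κ, ← Finset.smul_sum]
  simp only [← Fintype.sum_prod_type' (f := fun a b => stressCoeff v cs _ a b • N a b)]
  rw [sum_smul_sum_smul μ (fun i (p : Fin d × Fin d) => stressCoeff v cs i p.1 p.2)
    (fun p => N p.1 p.2)]
  simp [hμ]

/-- Collisions conserve mass. -/
theorem IsIsotropicLattice.sum_collision (hL : IsIsotropicLattice v w cs) (κ : ℝ)
    (X : Fin (n + 1) → H) (N : Fin d → Fin d → H) :
    ∑ i, w i • (linearEquilibrium v w cs X i + quadraticEquilibrium v cs κ N i - X i) = 0 := by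
  have h1 : ∑ i, w i • (1 / cs ^ 2) • ∑ a, v i a • ∑ j, (w j * v j a) • X j = 0 := by
    simp only [smul_comm _ (1 / cs ^ 2), ← Finset.smul_sum]
    rw [sum_smul_sum_smul w (fun i a => v i a)]
    simp [hL.moment_one]
  simp only [linearEquilibrium, smul_sub, smul_add, Finset.sum_sub_distrib, Finset.sum_add_distrib]
  rw [h1, sum_smul_quadraticEquilibrium w κ N hL.sum_stressCoeff, ← Finset.sum_smul, hL.moment_zero,
    one_smul]
  abel

/-- Collisions conserve momentum. -/
theorem IsIsotropicLattice.sum_velocity_collision (hL : IsIsotropicLattice v w cs) (κ : ℝ)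
    (X : Fin (n + 1) → H) (N : Fin d → Fin d → H) (c : Fin d) :
    ∑ i, (w i * v i c) • (linearEquilibrium v w cs X i + quadraticEquilibrium v cs κ N i - X i)
      = 0 := by
  have h1 : ∑ i, (w i * v i c) • (1 / cs ^ 2) • ∑ a, v i a • ∑ j, (w j * v j a) • X j
      = ∑ j, (w j * v j c) • X j := by
    simp only [smul_comm _ (1 / cs ^ 2), ← Finset.smul_sum]
    rw [sum_smul_sum_smul (fun i => w i * v i c) (fun i a => v i a)]
    simp only [hL.moment_two]
    rw [Finset.sum_eq_single c (fun b _ hb => by simp [hb.symm]) (by simp), if_pos rfl, mul_one,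
      smul_smul, one_div, inv_mul_cancel₀ (pow_ne_zero 2 hL.cs_pos.ne'), one_smul]
  simp only [linearEquilibrium, smul_sub, smul_add, Finset.sum_sub_distrib, Finset.sum_add_distrib]
  rw [h1, sum_smul_quadraticEquilibrium (fun i => w i * v i c) κ N
    (fun a b => hL.sum_velocity_stressCoeff a b c), ← Finset.sum_smul, hL.moment_one, zero_smul]
  abel

/-- Since `h_i = 𝒢_{i,eq} - g_i` has vanishing mass and momentum, it is orthogonal to the linear part
of the equilibrium, and so `∑ w_i ⟨h_i, g_i⟩ = ∑ w_i ⟨h_i, Q_i - h_i⟩`, where `Q_i` is the quadratic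
part of the equilibrium. -/
theorem IsIsotropicLattice.sum_inner_collision_le (hL : IsIsotropicLattice v w cs) (κ : ℝ)
    (X : Fin (n + 1) → H) (N : Fin d → Fin d → H) :
    2 * ∑ i, w i * inner ℝ (X i)
        (linearEquilibrium v w cs X i + quadraticEquilibrium v cs κ N i - X i)
      ≤ ∑ i, w i * ‖quadraticEquilibrium v cs κ N i‖ ^ 2
        - ∑ i, w i * ‖linearEquilibrium v w cs X i + quadraticEquilibrium v cs κ N i - X i‖ ^ 2 := by
  set P := linearEquilibrium v w cs X
  set Q := quadraticEquilibrium v cs κ N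
  set h : Fin (n + 1) → H := fun i => P i + Q i - X i with hh
  have h0 : ∑ i, w i • h i = 0 := hL.sum_collision κ X N
  have h1 : ∀ c, ∑ i, (w i * v i c) • h i = 0 := hL.sum_velocity_collision κ X N
  have horth : ∑ i, w i * inner ℝ (P i) (h i) = 0 := by
    -- `P_i = M + v_i · U / cs²` with `M` and `U` independent of `i`
    have e : ∀ i, w i * inner ℝ (P i) (h i) = inner ℝ (∑ j, w j • X j) (w i • h i)
        + (1 / cs ^ 2) * ∑ a, inner ℝ (∑ j, (w j * v j a) • X j) ((w i * v i a) • h i) := by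
      intro i
      change w i * inner ℝ (∑ j, w j • X j + (1 / cs ^ 2) • ∑ a, v i a • ∑ j, (w j * v j a) • X j)
        (h i) = _
      generalize ∑ j, w j • X j = M
      rw [inner_add_left, real_inner_smul_left, sum_inner, mul_add, real_inner_smul_right,
        mul_left_comm, Finset.mul_sum]
      simp only [real_inner_smul_left, real_inner_smul_right, mul_assoc]
    have e0 : ∑ i, inner ℝ (∑ j, w j • X j) (w i • h i) = 0 := by
      rw [← inner_sum, h0, inner_zero_right]
    have e1 : ∑ i, ∑ a, inner ℝ (∑ j, (w j * v j a) • X j) ((w i * v i a) • h i) = 0 := by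
      rw [Finset.sum_comm]
      exact Finset.sum_eq_zero fun a _ => by rw [← inner_sum, h1, inner_zero_right]
    rw [Finset.sum_congr rfl fun i _ => e i, Finset.sum_add_distrib, e0, ← Finset.mul_sum, e1,
      mul_zero, add_zero]
  have hX : ∀ i, w i * inner ℝ (X i) (h i)
      = w i * inner ℝ (P i) (h i) + w i * (inner ℝ (Q i) (h i) - ‖h i‖ ^ 2) := by
    intro i
    have e : X i = P i + (Q i - h i) := by
      change X i = P i + (Q i - (P i + Q i - X i))
      abel
    have e' : inner ℝ (X i) (h i) = inner ℝ (P i + (Q i - h i)) (h i) := by rw [← e]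
    rw [e', ← mul_add, inner_add_left, inner_sub_left, real_inner_self_eq_norm_sq]
  have hsum : ∑ i, w i * inner ℝ (X i) (h i) = ∑ i, w i * (inner ℝ (Q i) (h i) - ‖h i‖ ^ 2) := by
    rw [Finset.sum_congr rfl fun i _ => hX i, Finset.sum_add_distrib, horth, zero_add]
  change 2 * ∑ i, w i * inner ℝ (X i) (h i) ≤ ∑ i, w i * ‖Q i‖ ^ 2 - ∑ i, w i * ‖h i‖ ^ 2
  rw [hsum, Finset.mul_sum, ← Finset.sum_sub_distrib]
  refine Finset.sum_le_sum fun i _ => ?_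
  have h2 := norm_sub_sq_real (Q i) (h i)
  have h3 : 0 ≤ w i * ‖Q i - h i‖ ^ 2 := mul_nonneg (hL.w_pos i).le (sq_nonneg _)
  rw [h2] at h3
  linarith

theorem norm_quadraticEquilibrium_sq_le (κ : ℝ) (N : Fin d → Fin d → H) (i : Fin (n + 1)) :
    ‖quadraticEquilibrium v cs κ N i‖ ^ 2
      ≤ κ ^ 2 * (∑ a, ∑ b, stressCoeff v cs i a b ^ 2) * ∑ a, ∑ b, ‖N a b‖ ^ 2 := by
  rw [quadraticEquilibrium, norm_smul, mul_pow, Real.norm_eq_abs, sq_abs, mul_assoc]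
  refine mul_le_mul_of_nonneg_left ?_ (sq_nonneg _)
  simp only [← Fintype.sum_prod_type' (f := fun a b => stressCoeff v cs _ a b • N a b),
    ← Fintype.sum_prod_type' (f := fun a b => stressCoeff v cs i a b ^ 2),
    ← Fintype.sum_prod_type' (f := fun a b => ‖N a b‖ ^ 2)]
  calc ‖∑ p : Fin d × Fin d, stressCoeff v cs i p.1 p.2 • N p.1 p.2‖ ^ 2
      ≤ (∑ p : Fin d × Fin d, |stressCoeff v cs i p.1 p.2| * ‖N p.1 p.2‖) ^ 2 := by
        refine pow_le_pow_left₀ (norm_nonneg _) ((norm_sum_le _ _).trans (le_of_eq ?_)) 2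
        simp only [norm_smul, Real.norm_eq_abs]
    _ ≤ (∑ p : Fin d × Fin d, |stressCoeff v cs i p.1 p.2| ^ 2)
          * ∑ p : Fin d × Fin d, ‖N p.1 p.2‖ ^ 2 := Finset.sum_mul_sq_le_sq_mul_sq _ _ _
    _ = _ := by simp only [sq_abs]

/-- The Cauchy-Schwarz inequality with weights `w_i`, as `∑ w_i v_{i,a}² = cs²`. -/
theorem IsIsotropicLattice.norm_momentum_sq_le (hL : IsIsotropicLattice v w cs)
    (X : Fin (n + 1) → H) (a : Fin d) :
    ‖∑ i, (w i * v i a) • X i‖ ^ 2 ≤ cs ^ 2 * ∑ i, w i * ‖X i‖ ^ 2 := by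
  have h1 : ∑ i, w i * v i a ^ 2 = cs ^ 2 := by
    have := hL.moment_two a a
    rw [if_pos rfl, mul_one] at this
    rw [← this]
    exact Finset.sum_congr rfl fun i _ => by ring
  rw [← h1]
  calc ‖∑ i, (w i * v i a) • X i‖ ^ 2 ≤ (∑ i, ‖(w i * v i a) • X i‖) ^ 2 :=
        pow_le_pow_left₀ (norm_nonneg _) (norm_sum_le _ _) 2
    _ ≤ _ := by
        refine Finset.sum_sq_le_sum_mul_sum_of_sq_le_mul _
          (fun i _ => mul_nonneg (hL.w_pos i).le (sq_nonneg _))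
          (fun i _ => mul_nonneg (hL.w_pos i).le (sq_nonneg _)) fun i _ => le_of_eq ?_
        rw [norm_smul, mul_pow, Real.norm_eq_abs, sq_abs]
        ring

end Collision

/-! ### The energy inequality -/

/-- The pairs `(k, τ)` with `k = |τ| ≤ m`. -/
def multiIndices (d m : ℕ) : Finset (Σ _ : ℕ, (Fin d → ℕ)) :=
  (Finset.range (m + 1)).sigma fun k => Finset.piAntidiag (Finset.univ : Finset (Fin d)) k

/-- All derivatives of order at most `m` of `Λ_ε f`, as an element of a Hilbert space. -/
noncomputable def jet {d : ℕ} (ε : ℝ) (m : ℕ) :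
    L2 d →L[ℝ] PiLp 2 (fun _ : multiIndices d m => L2 d) :=
  ((PiLp.continuousLinearEquiv 2 ℝ (fun _ : multiIndices d m => L2 d)).symm :
      (multiIndices d m → L2 d) →L[ℝ] PiLp 2 (fun _ : multiIndices d m => L2 d)).comp
    (ContinuousLinearMap.pi fun p => truncDeriv ε p.1.2)

theorem jet_apply {d : ℕ} (ε : ℝ) (m : ℕ) (f : L2 d) (p : multiIndices d m) :
    jet ε m f p = truncDeriv ε p.1.2 f := rfl

theorem norm_jet_sq {d : ℕ} (ε : ℝ) (m : ℕ) (f : L2 d) : ‖jet ε m f‖ ^ 2 = bandNormSq ε m f := by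
  rw [PiLp.norm_sq_eq_of_L2, bandNormSq]
  simp only [jet_apply]
  rw [Finset.sum_coe_sort (multiIndices d m) (fun p => ‖truncDeriv ε p.2 f‖ ^ 2), multiIndices,
    Finset.sum_sigma]

theorem jet_cutoff {d : ℕ} (ε : ℝ) (m : ℕ) (f : L2 d) : jet ε m (cutoff ε f) = jet ε m f := by
  ext1 p
  rw [jet_apply, jet_apply, truncDeriv_cutoff]

theorem inner_jet_truncDeriv_single {d : ℕ} (ε : ℝ) (m : ℕ) (a : Fin d) (f : L2 d) :
    inner ℝ (jet ε m f) (jet ε m (truncDeriv ε (Pi.single a 1) f)) = 0 := by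
  rw [PiLp.inner_apply]
  exact Finset.sum_eq_zero fun p _ => inner_truncDeriv_truncDeriv_single ε p.1.2 a f

/-- A function with `f' ≤ k f²` and `f 0 ≤ A` grows by a factor of at most `3 / 2` up to a time `T`
with `9 k A T < 2`. -/
theorem le_of_deriv_right_le_mul_sq {f f' : ℝ → ℝ} {k A S T : ℝ} (hk : 0 ≤ k) (hT : 0 < T)
    (hST : S ≤ T) (hA : 0 ≤ A) (hkA : 9 * k * A * T < 2) (hf : ContinuousOn f (Icc 0 S))
    (hf' : ∀ t ∈ Ico 0 S, HasDerivWithinAt f (f' t) (Ici t) t) (h0 : f 0 ≤ A)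
    (hbound : ∀ t ∈ Ico 0 S, f' t ≤ k * f t ^ 2) : ∀ t ∈ Icc 0 S, f t ≤ 3 / 2 * A := by
  -- For `B > A` the affine function `B (1 + t / (2 T))` is a strict upper barrier.
  have key : ∀ B, A < B → 9 * k * B * T < 2 → ∀ t ∈ Icc 0 S, f t ≤ 3 / 2 * B := by
    intro B hAB hkB t ht
    have hB : 0 < B := hA.trans_lt hAB
    have hder : ∀ s ∈ Ico 0 S,
        HasDerivWithinAt (fun s => B * (1 + s / (2 * T))) (B * (1 / (2 * T))) (Ici s) s :=
      fun s _ => ((((hasDerivAt_id s).div_const (2 * T)).const_add 1).const_mul B).hasDerivWithinAt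
    have hle : ∀ s ≤ S, B * (1 + s / (2 * T)) ≤ 3 / 2 * B := by
      intro s hs
      have : s / (2 * T) ≤ 1 / 2 := by
        rw [div_le_div_iff₀ (by positivity) (by norm_num)]
        linarith
      nlinarith
    refine (image_le_of_deriv_right_lt_deriv_boundary' hf hf' (B := fun s => B * (1 + s / (2 * T)))
      (by simpa using h0.trans hAB.le) (by fun_prop) hder ?_ ht).trans (hle t ht.2)
    intro s hs hfs
    refine (hbound s hs).trans_lt ?_
    have h1 : 0 ≤ f s := by
      rw [hfs]
      have : 0 ≤ s / (2 * T) := div_nonneg hs.1 (by positivity)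
      positivity
    have h2 : f s ≤ 3 / 2 * B := by
      rw [hfs]
      exact hle s hs.2.le
    calc k * f s ^ 2 ≤ k * (3 / 2 * B) ^ 2 :=
          mul_le_mul_of_nonneg_left (pow_le_pow_left₀ h1 h2 2) hk
      _ = 9 * k * B * T * (B * (1 / (4 * T))) := by field_simp; ring
      _ < 2 * (B * (1 / (4 * T))) := mul_lt_mul_of_pos_right hkB (by positivity)
      _ = B * (1 / (2 * T)) := by ring
  intro t ht
  have hlim : Filter.Tendsto (fun B : ℝ => 3 / 2 * B) (nhdsWithin A (Ioi A)) (nhds (3 / 2 * A)) :=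
    ((continuous_const.mul continuous_id).tendsto A).mono_left nhdsWithin_le_nhds
  refine ge_of_tendsto hlim ?_
  have hsmall : ∀ᶠ B in nhdsWithin A (Ioi A), 9 * k * B * T < 2 :=
    (((by fun_prop : Continuous fun B : ℝ => 9 * k * B * T).tendsto A).mono_left
      nhdsWithin_le_nhds).eventually_lt_const hkA
  filter_upwards [hsmall, self_mem_nhdsWithin] with B h1 h2 using key B h2 h1 t ht

variable {d n : ℕ} {v : Fin (n + 1) → Space d} {w : Fin (n + 1) → ℝ} {cs : ℝ}

theorem jet_equilibrium (ε : ℝ) (m : ℕ) (g : State d n) (i : Fin (n + 1)) :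
    jet ε m (equilibrium ε v w cs g i)
      = linearEquilibrium v w cs (fun j => jet ε m (g j)) i
        + quadraticEquilibrium v cs (ε / (2 * cs ^ 4)) (fun a b =>
            jet ε m (mulL2 (cutoffVelocity ε v w g a) (cutoffVelocity ε v w g b))) i := by
  simp only [equilibrium, cutoffDensity, cutoffVelocity, linearEquilibrium, quadraticEquilibrium,
    stressCoeff, map_add, map_sum, map_smul, jet_cutoff]

theorem stateNormSq_stateCutoff_eq_jet (ε : ℝ) (m : ℕ) (w : Fin (n + 1) → ℝ) (g : State d n) :
    stateNormSq m w (stateCutoff ε g) = ∑ i, w i * ‖jet ε m (g i)‖ ^ 2 := by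
  simp only [stateNormSq_stateCutoff, norm_jet_sq]

theorem continuous_stateNormSq_stateCutoff (ε : ℝ) (m : ℕ) (w : Fin (n + 1) → ℝ) :
    Continuous fun g : State d n => stateNormSq m w (stateCutoff ε g) := by
  simp only [stateNormSq_stateCutoff_eq_jet]
  fun_prop

/-- The constant in front of the cubic term of the energy inequality, `C` being the constant of the
product estimate in `H^m`. It depends neither on the weights nor on `ε` and `ν`. -/
noncomputable def energyConst {d n : ℕ} (v : Fin (n + 1) → Space d) (cs C : ℝ) : ℝ :=
  (∑ i, ∑ a, ∑ b, stressCoeff v cs i a b ^ 2) * (d ^ 2 * C) / (4 * cs ^ 4)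

theorem energyConst_nonneg (v : Fin (n + 1) → Space d) (cs : ℝ) {C : ℝ} (hC : 0 ≤ C) :
    0 ≤ energyConst v cs C := by
  unfold energyConst
  positivity

/-- The quadratic part of the equilibrium is `O(ε)`, with the square of the energy as a bound: the
factor `ε²` cancels the singular prefactor `1 / ε²` of the collision term. -/
theorem IsIsotropicLattice.sum_norm_quadraticEquilibrium_sq_le (hL : IsIsotropicLattice v w cs)
    {m : ℕ} {C : ℝ} (hC0 : 0 ≤ C)
    (hC : ∀ (ε : ℝ) (f g : L2 d), bandNormSq ε m (mulL2 (cutoff ε f) (cutoff ε g))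
      ≤ C * bandNormSq ε m f * bandNormSq ε m g) (ε : ℝ) (g : State d n) :
    ∑ i, w i * ‖quadraticEquilibrium v cs (ε / (2 * cs ^ 4)) (fun a b =>
        jet ε m (mulL2 (cutoffVelocity ε v w g a) (cutoffVelocity ε v w g b))) i‖ ^ 2
      ≤ ε ^ 2 * (energyConst v cs C * stateNormSq m w (stateCutoff ε g) ^ 2) := by
  set Y := stateNormSq m w (stateCutoff ε g) with hY
  have hcs := hL.cs_pos
  have hmom : ∀ a, bandNormSq ε m (momentum v w a g) ≤ cs ^ 2 * Y := by
    intro a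
    have := hL.norm_momentum_sq_le (fun i => jet ε m (g i)) a
    rw [← norm_jet_sq, hY, stateNormSq_stateCutoff_eq_jet, momentum_apply, map_sum]
    simpa only [map_smul] using this
  have hN : ∀ a b, ‖jet ε m (mulL2 (cutoffVelocity ε v w g a) (cutoffVelocity ε v w g b))‖ ^ 2
      ≤ C * (cs ^ 2 * Y) ^ 2 := by
    intro a b
    rw [norm_jet_sq, cutoffVelocity_eq, cutoffVelocity_eq]
    refine (hC _ _ _).trans ?_
    rw [mul_assoc, sq]
    exact mul_le_mul_of_nonneg_left (mul_le_mul (hmom a) (hmom b) (bandNormSq_nonneg _ _ _)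
      ((bandNormSq_nonneg _ _ _).trans (hmom a))) hC0
  have hNsum : ∑ a, ∑ b,
      ‖jet ε m (mulL2 (cutoffVelocity ε v w g a) (cutoffVelocity ε v w g b))‖ ^ 2
      ≤ d ^ 2 * (C * (cs ^ 2 * Y) ^ 2) := by
    refine (Finset.sum_le_sum fun a _ => Finset.sum_le_sum fun b _ => hN a b).trans (le_of_eq ?_)
    simp only [Finset.sum_const, Finset.card_univ, Fintype.card_fin, nsmul_eq_mul]
    ring
  have hi : ∀ i, w i * ‖quadraticEquilibrium v cs (ε / (2 * cs ^ 4)) (fun a b =>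
      jet ε m (mulL2 (cutoffVelocity ε v w g a) (cutoffVelocity ε v w g b))) i‖ ^ 2
      ≤ (ε / (2 * cs ^ 4)) ^ 2 * (∑ a, ∑ b, stressCoeff v cs i a b ^ 2)
        * (d ^ 2 * (C * (cs ^ 2 * Y) ^ 2)) := by
    intro i
    refine (mul_le_of_le_one_left (sq_nonneg _) (hL.weight_le_one i)).trans
      ((norm_quadraticEquilibrium_sq_le _ _ i).trans ?_)
    exact mul_le_mul_of_nonneg_left hNsum (by positivity)
  refine (Finset.sum_le_sum fun i _ => hi i).trans (le_of_eq ?_)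
  rw [← Finset.sum_mul, ← Finset.mul_sum, energyConst]
  field_simp
  ring

/-- The energy inequality in differential form: transport is skew-symmetric, and the collision term
dissipates up to the quadratic part of the equilibrium. -/
theorem IsIsotropicLattice.energy_rate_le (hL : IsIsotropicLattice v w cs)
    {m : ℕ} {C : ℝ} (hC0 : 0 ≤ C)
    (hC : ∀ (ε : ℝ) (f g : L2 d), bandNormSq ε m (mulL2 (cutoff ε f) (cutoff ε g))
      ≤ C * bandNormSq ε m f * bandNormSq ε m g) {ε ν : ℝ} (hε : 0 < ε) (hν : 0 < ν)
    (g : State d n) :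
    ∑ i, w i * (2 * inner ℝ (jet ε m (g i)) (jet ε m (field ε ν v w cs g i)))
        + 1 / (ε ^ 2 * ν) * stateNormSq m w (stateCutoff ε (equilibrium ε v w cs g - g))
      ≤ energyConst v cs C / ν * stateNormSq m w (stateCutoff ε g) ^ 2 := by
  have hfield : ∀ i, inner ℝ (jet ε m (g i)) (jet ε m (field ε ν v w cs g i))
      = 1 / (ε ^ 2 * ν) * inner ℝ (jet ε m (g i))
        (jet ε m (equilibrium ε v w cs g i) - jet ε m (g i)) := by
    intro i
    have e : field ε ν v w cs g i = ε⁻¹ • ((1 / (ε * ν)) • (equilibrium ε v w cs g i - cutoff ε (g i))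
        - transport v (stateCutoff ε g) i) := rfl
    rw [e, transport_stateCutoff]
    simp only [map_smul, map_sub, map_sum, jet_cutoff, inner_smul_right, inner_sub_right, inner_sum,
      inner_jet_truncDeriv_single, mul_zero, Finset.sum_const_zero, sub_zero]
    field_simp
  have hcoll := hL.sum_inner_collision_le (ε / (2 * cs ^ 4)) (fun i => jet ε m (g i))
    (fun a b => jet ε m (mulL2 (cutoffVelocity ε v w g a) (cutoffVelocity ε v w g b)))
  simp only [← jet_equilibrium] at hcoll
  have hQ := hL.sum_norm_quadraticEquilibrium_sq_le hC0 hC ε g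
  have hD : stateNormSq m w (stateCutoff ε (equilibrium ε v w cs g - g))
      = ∑ i, w i * ‖jet ε m (equilibrium ε v w cs g i) - jet ε m (g i)‖ ^ 2 := by
    simp only [stateNormSq_stateCutoff_eq_jet, Pi.sub_apply, map_sub]
  have hsum : ∑ i, w i * (2 * inner ℝ (jet ε m (g i)) (jet ε m (field ε ν v w cs g i)))
      = 1 / (ε ^ 2 * ν) * (2 * ∑ i, w i * inner ℝ (jet ε m (g i))
        (jet ε m (equilibrium ε v w cs g i) - jet ε m (g i))) := by
    rw [Finset.mul_sum, Finset.mul_sum]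
    exact Finset.sum_congr rfl fun i _ => by rw [hfield]; ring
  rw [hsum, hD, ← mul_add]
  calc _ ≤ 1 / (ε ^ 2 * ν) * (ε ^ 2 * (energyConst v cs C * stateNormSq m w (stateCutoff ε g) ^ 2)) :=
        mul_le_mul_of_nonneg_left (by linarith) (by positivity)
    _ = _ := by field_simp

theorem hasDerivWithinAt_stateNormSq_stateCutoff (ε : ℝ) (m : ℕ) (w : Fin (n + 1) → ℝ)
    {x : ℝ → State d n} {x' : State d n} {s : Set ℝ} {t : ℝ} (hx : HasDerivWithinAt x x' s t) :
    HasDerivWithinAt (fun t => stateNormSq m w (stateCutoff ε (x t)))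
      (∑ i, w i * (2 * inner ℝ (jet ε m (x t i)) (jet ε m (x' i)))) s t := by
  simp only [stateNormSq_stateCutoff_eq_jet]
  refine HasDerivWithinAt.fun_sum fun i _ => HasDerivWithinAt.const_mul (w i) ?_
  exact HasDerivWithinAt.norm_sq
    ((jet ε m).hasFDerivAt.comp_hasDerivWithinAt t (hasDerivWithinAt_pi.1 hx i))

/-- The energy inequality: as long as `9 K A T < 2 ν` for the constant `K` of the cubic term, energy
plus dissipation stay below `3 A / 2` up to time `T`. -/
theorem IsIsotropicLattice.energy_le (hL : IsIsotropicLattice v w cs) (hd : 0 < d)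
    {m : ℕ} {C : ℝ} (hC0 : 0 ≤ C)
    (hC : ∀ (ε : ℝ) (f g : L2 d), bandNormSq ε m (mulL2 (cutoff ε f) (cutoff ε g))
      ≤ C * bandNormSq ε m f * bandNormSq ε m g) {ε ν : ℝ} (hε : 0 < ε) (hν : 0 < ν)
    {x : ℝ → State d n} {S T A : ℝ} (hS : 0 ≤ S) (hT : 0 < T) (hST : S ≤ T)
    (hx : IsIntegralCurveOn x (fun _ => field ε ν v w cs) (Icc 0 S))
    (hA : stateNormSq m w (stateCutoff ε (x 0)) ≤ A)
    (hAT : 9 * (energyConst v cs C / ν) * A * T < 2) :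
    ∀ t ∈ Icc 0 S, stateNormSq m w (stateCutoff ε (x t))
      + 1 / (ε ^ 2 * ν) * ∫ s in (0 : ℝ)..t,
          stateNormSq m w (stateCutoff ε (equilibrium ε v w cs (x s) - x s)) ≤ 3 / 2 * A := by
  have hw := hL.w_pos
  have hxc : ContinuousOn x (Icc 0 S) := IsIntegralCurveOn.continuousOn_Icc hx
  -- The dissipation is extended continuously to all times.
  set y : ℝ → State d n := fun s => x (projIcc 0 S hS s) with hy
  have hyc : Continuous y := hxc.domRestrict.comp continuous_projIcc
  have hyx : ∀ s ∈ Icc 0 S, y s = x s := fun s hs => by rw [hy]; simp only [projIcc_of_mem hS hs]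
  set D : ℝ → ℝ := fun s => stateNormSq m w (stateCutoff ε (equilibrium ε v w cs (y s) - y s))
  have hD : Continuous D := (continuous_stateNormSq_stateCutoff ε m w).comp
    (((lipschitzOnBalls_equilibrium ε v w cs hd).continuous.comp hyc).sub hyc)
  have hD0 : ∀ s, 0 ≤ D s := fun s => stateNormSq_nonneg hw m _
  have hint : ∀ t ∈ Icc 0 S, ∫ s in (0 : ℝ)..t,
      stateNormSq m w (stateCutoff ε (equilibrium ε v w cs (x s) - x s)) = ∫ s in (0 : ℝ)..t, D s := by
    intro t ht
    refine intervalIntegral.integral_congr fun s hs => ?_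
    rw [uIcc_of_le ht.1] at hs
    simp only [D, hyx s ⟨hs.1, hs.2.trans ht.2⟩]
  have hprim : ∀ t, HasDerivAt (fun t => ∫ s in (0 : ℝ)..t, D s) (D t) t :=
    fun t => (hD.integral_hasStrictDerivAt 0 t).hasDerivAt
  have hmain := le_of_deriv_right_le_mul_sq
    (f := fun t => stateNormSq m w (stateCutoff ε (x t))
      + 1 / (ε ^ 2 * ν) * ∫ s in (0 : ℝ)..t, D s)
    (f' := fun t => ∑ i, w i * (2 * inner ℝ (jet ε m (x t i)) (jet ε m (field ε ν v w cs (x t) i)))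
      + 1 / (ε ^ 2 * ν) * D t)
    (div_nonneg (energyConst_nonneg v cs hC0) hν.le) hT hST
    ((stateNormSq_nonneg hw m _).trans hA) hAT ?_ ?_ (by simpa using hA) ?_
  · intro t ht
    rw [hint t ht]
    exact hmain t ht
  · refine ((continuous_stateNormSq_stateCutoff ε m w).comp_continuousOn hxc).add
      (continuousOn_const.mul ?_)
    exact fun t _ => (hprim t).continuousAt.continuousWithinAt
  · intro t ht
    exact (hasDerivWithinAt_stateNormSq_stateCutoff ε m w
      (IsIntegralCurveOn.hasDerivWithinAt_Ici hx ht)).add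
      ((hprim t).hasDerivWithinAt.const_mul _)
  · intro t ht
    have h1 := hL.energy_rate_le hC0 hC hε hν (x t)
    have h2 : D t = stateNormSq m w (stateCutoff ε (equilibrium ε v w cs (x t) - x t)) := by
      simp only [D, hyx t (Ico_subset_Icc_self ht)]
    have h3 : 0 ≤ ∫ s in (0 : ℝ)..t, D s := intervalIntegral.integral_nonneg ht.1 fun s _ => hD0 s
    have h4 : 0 ≤ stateNormSq m w (stateCutoff ε (x t)) := stateNormSq_nonneg hw m _
    change _ + 1 / (ε ^ 2 * ν) * D t ≤ _
    rw [h2]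
    refine h1.trans (mul_le_mul_of_nonneg_left (pow_le_pow_left₀ h4 ?_ 2)
      (div_nonneg (energyConst_nonneg v cs hC0) hν.le))
    exact le_add_of_nonneg_right (mul_nonneg (by positivity) h3)

/-! ### Well-posedness -/

section WellPosed

variable {d n m : ℕ} {v : Fin (n + 1) → Space d} {w : Fin (n + 1) → ℝ} {cs ε ν T : ℝ}
  {g0 : State d n}

theorem stateCutoff_sub (ε : ℝ) (g h : State d n) :
    stateCutoff ε (g - h) = stateCutoff ε g - stateCutoff ε h := by
  simp only [← stateCutoffCLM_apply, map_sub]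

/-- An integral curve that starts at `Λ_ε g⁰` makes the problem well-posed: the field is Lipschitz on
balls, and on the range of `Λ_ε` the norms of `H^m` and `L²` are equivalent. -/
theorem isWellPosed_of_isIntegralCurveOn (hd : 0 < d) (hε : ε ≠ 0) (hT : 0 ≤ T)
    (hw : ∀ i, 0 < w i) {x : ℝ → State d n}
    (hx : IsIntegralCurveOn x (fun _ => field ε ν v w cs) (Icc 0 T))
    (hx0 : x 0 = stateCutoff ε g0) : IsWellPosed m ε ν v w cs T g0 := by
  have hF := lipschitzOnBalls_field ε ν v w cs hd
  have huniq : ∀ T' : ℝ, 0 ≤ T' → ∀ k : State d n, ∀ g h : ℝ → State d n,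
      IsSolution m ε ν v w cs T' k g → h 0 = stateCutoff ε k →
      IsIntegralCurveOn h (fun _ => field ε ν v w cs) (Icc 0 T') →
      ∀ t ∈ Icc 0 T', stateCutoff ε (g t) = h t := by
    intro T' hT' k g h hg h0 hh t ht
    obtain ⟨g1, g2⟩ := isIntegralCurveOn_of_isSolution hd hε hT' hg
    exact eqOn_of_isIntegralCurveOn hF g2 hh (g1.trans h0.symm) ht
  refine ⟨⟨x, isBandLimitedSolution_of_isIntegralCurveOn hd hε hT hw hx hx0⟩, ?_, ?_⟩
  · intro T' hT' _ g h hg hh t ht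
    obtain ⟨h1, h2⟩ := isIntegralCurveOn_of_isSolution hd hε hT'.le hh
    exact huniq T' hT'.le g0 g _ hg h1 h2 t ht
  · intro δ hδ
    obtain ⟨M, hM, hMle⟩ := exists_stateNormSq_stateCutoff_le (d := d) ε hw m
    obtain ⟨c, hc, hcle⟩ := exists_norm_stateCutoff_sq_le (d := d) ε hw m
    -- `‖·‖² ≤ δ / (M + 1)` implies `stateNormSq < δ`, and `stateNormSq < η² / c` implies `‖·‖ < η`.
    set δ' := Real.sqrt (δ / (M + 1)) with hδ'
    have hδ'0 : 0 < δ' := Real.sqrt_pos.2 (by positivity)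
    obtain ⟨η, hη, hnear⟩ := exists_isIntegralCurveOn_near hF hT hx hδ'0
    refine ⟨η ^ 2 / c, by positivity, fun h0 _ hh0 => ?_⟩
    have hdist : dist (stateCutoff ε h0) (x 0) < η := by
      rw [hx0, dist_eq_norm, ← stateCutoff_sub]
      refine lt_of_pow_lt_pow_left₀ 2 hη.le ?_
      have h1 := hcle (h0 - g0)
      rw [stateCutoff_sub] at h1 ⊢
      refine h1.trans_lt ?_
      rwa [lt_div_iff₀ hc, mul_comm] at hh0
    obtain ⟨y, hy0, hy, hyx⟩ := hnear _ hdist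
    refine ⟨⟨y, isBandLimitedSolution_of_isIntegralCurveOn hd hε hT hw hy hy0⟩, ?_⟩
    intro g h hg hh t ht
    have e1 := huniq T hT g0 g x hg hx0 hx t ht
    have e2 := huniq T hT h0 h y hh hy0 hy t ht
    have e3 : stateCutoff ε (h t) - stateCutoff ε (g t) = stateCutoff ε (y t - x t) := by
      rw [stateCutoff_sub, ← e1, ← e2, stateCutoff_stateCutoff, stateCutoff_stateCutoff]
    rw [e3]
    have h3 : ‖y t - x t‖ ^ 2 ≤ δ / (M + 1) := by
      rw [← Real.sq_sqrt (show 0 ≤ δ / (M + 1) by positivity), ← dist_eq_norm]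
      exact pow_le_pow_left₀ dist_nonneg (hyx t ht).le 2
    calc stateNormSq m w (stateCutoff ε (y t - x t)) ≤ M * ‖y t - x t‖ ^ 2 := hMle _
      _ ≤ M * (δ / (M + 1)) := mul_le_mul_of_nonneg_left h3 hM
      _ < δ := by
        rw [mul_div_assoc', div_lt_iff₀ (by positivity)]
        nlinarith

end WellPosed

end LBGK

open LBGK in
theorem lemma1 (d n m : ℕ) (hd : 2 ≤ d) (hm : d < m)
    (v : Fin (n + 1) → EuclideanSpace ℝ (Fin d)) (cs : ℝ) :
    -- `c₀` depends on the velocities, `cs`, `m`, `d` only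
    ∃ c₀ : ℝ, 0 < c₀ ∧ ∀ ν : ℝ, 0 < ν →
    -- the time of existence is a function of the size of the initial data `Λ_ε(g0)` alone
    ∃ T : ℝ → ℝ, (∀ r, 0 < T r) ∧ AntitoneOn T (Set.Ioi 0) ∧
    ∀ w : Fin (n + 1) → ℝ, IsIsotropicLattice v w cs →
    ∀ ε : ℝ, 0 < ε → ∀ g0 : State d n, StateMemH m g0 →
    ∀ A T₀ : ℝ, A = stateNormSq m w (stateCutoff ε g0) → T₀ = T A →
      IsWellPosed m ε ν v w cs T₀ g0 ∧
      ∃ g : ℝ → State d n,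
        IsSolution m ε ν v w cs T₀ g0 g ∧
        g 0 = stateCutoff ε g0 ∧
        (∀ t ∈ Set.Icc 0 T₀, g t = stateCutoff ε (g t)) ∧
        -- the equation also holds pointwise in time
        (∀ t ∈ Set.Icc 0 T₀,
          HasDerivWithinAt g (ε⁻¹ • rhs ε ν v w cs (g t)) (Set.Icc 0 T₀) t) ∧
        -- the local energy inequality, all of whose terms are meaningful
        0 < ν - c₀ * T₀ * A ∧
        (∀ t ∈ Set.Icc 0 T₀, StateMemH m (equilibrium ε v w cs (g t))) ∧
        IntervalIntegrable
          (fun s => stateNormSq m w (equilibrium ε v w cs (g s) - g s)) MeasureTheory.volume 0 T₀ ∧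
        (⨆ t : Set.Icc (0 : ℝ) T₀, stateNormSq m w (g t))
            + (1 / ε ^ 2) * ∫ s in (0 : ℝ)..T₀, stateNormSq m w (equilibrium ε v w cs (g s) - g s)
          ≤ (ν + ν ^ 2) * A / (ν - c₀ * T₀ * A) - ν * A := by
  have hd0 : 0 < d := by lia
  obtain ⟨C, hC0, hC⟩ := exists_bandNormSq_mulL2_le hd0 hm
  set K := energyConst v cs C with hKdef
  have hK : 0 ≤ K := energyConst_nonneg v cs hC0
  refine ⟨4 * (K + 1), by positivity, fun ν hν => ?_⟩
  refine ⟨fun r => if 0 < r then 2 * ν / (3 * (4 * (K + 1)) * r) else 1, ?_, ?_, ?_⟩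
  · intro r
    dsimp only
    split_ifs with hr
    · positivity
    · exact one_pos
  · intro r hr s hs hrs
    dsimp only
    have hr' : 0 < r := hr
    have hs' : 0 < s := hs
    rw [if_pos hr', if_pos hs']
    gcongr
  intro w hL ε hε g0 _ A T₀ hA hT₀
  have hw := hL.w_pos
  have hA0 : 0 ≤ A := hA ▸ stateNormSq_nonneg hw m _
  have hT : 0 < T₀ := by
    rw [hT₀]
    dsimp only
    split_ifs with hr
    · positivity
    · exact one_pos
  -- Either `c₀ T₀ A = 2 ν / 3`, or `A = 0`.
  have hcTA : 4 * (K + 1) * T₀ * A = 2 / 3 * ν ∨ A = 0 := by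
    rcases hA0.lt_or_eq with h | h
    · left
      rw [hT₀]
      dsimp only
      rw [if_pos h]
      field_simp
    · exact Or.inr h.symm
  have hsmall : 9 * (K / ν) * A * T₀ < 2 := by
    rcases hcTA with h | h
    · have h1 : 0 ≤ T₀ * A := by positivity
      have h2 : 9 * (K / ν) * A * T₀ = 9 * (K * (T₀ * A)) / ν := by ring
      rw [h2, div_lt_iff₀ hν]
      have h3 : 0 < T₀ * A := by
        refine h1.lt_of_ne fun h0 => ?_
        rw [mul_assoc, ← h0] at h
        linarith
      nlinarith
    · simp [h]
  have henergy : ∀ t ∈ Icc 0 T₀, ∀ x : ℝ → State d n, x 0 = stateCutoff ε g0 →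
      IsIntegralCurveOn x (fun _ => field ε ν v w cs) (Icc 0 t) → ∀ s ∈ Icc 0 t,
      stateNormSq m w (stateCutoff ε (x s)) + 1 / (ε ^ 2 * ν) * ∫ r in (0 : ℝ)..s,
        stateNormSq m w (stateCutoff ε (equilibrium ε v w cs (x r) - x r)) ≤ 3 / 2 * A := by
    intro t ht x hx0 hx
    refine hL.energy_le hd0 hC0 hC hε hν ht.1 hT ht.2 hx (le_of_eq ?_) hsmall
    rw [hx0, stateCutoff_stateCutoff, hA]
  have hpos : ∀ x : ℝ → State d n, ∀ t, 0 ≤ t → 0 ≤ 1 / (ε ^ 2 * ν) * ∫ r in (0 : ℝ)..t,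
      stateNormSq m w (stateCutoff ε (equilibrium ε v w cs (x r) - x r)) := fun x t ht =>
    mul_nonneg (by positivity)
      (intervalIntegral.integral_nonneg ht fun s _ => stateNormSq_nonneg hw m _)
  obtain ⟨c, hc, hcle⟩ := exists_norm_stateCutoff_sq_le (d := d) ε hw m
  obtain ⟨x, hx0, hx⟩ := exists_isIntegralCurveOn_of_apriori_bound
    (lipschitzOnBalls_field ε ν v w cs hd0) hT.le (stateCutoff ε g0)
    (R := Real.sqrt (c * (3 / 2 * A))) (by
      intro t ht x hx0 hx
      refine Real.le_sqrt_of_sq_le ?_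
      have hband := stateCutoff_eq_of_isIntegralCurveOn hd0 hx hx0 (t := t) ⟨ht.1, le_rfl⟩
      have h1 := henergy t ht x hx0 hx t ⟨ht.1, le_rfl⟩
      have h2 := hpos x t ht.1
      have h3 := hcle (x t)
      rw [hband] at h1 h3
      exact h3.trans (mul_le_mul_of_nonneg_left (by linarith) hc.le))
  have hband : ∀ t ∈ Icc 0 T₀, stateCutoff ε (x t) = x t := fun t ht =>
    stateCutoff_eq_of_isIntegralCurveOn hd0 hx hx0 ht
  -- All states in the asserted inequality are band-limited, so that `Λ_ε` can be inserted.
  have hdiss : ∀ t ∈ Icc 0 T₀, stateNormSq m w (equilibrium ε v w cs (x t) - x t)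
      = stateNormSq m w (stateCutoff ε (equilibrium ε v w cs (x t) - x t)) := fun t ht => by
    rw [stateCutoff_sub, stateCutoff_equilibrium, hband t ht]
  have hE := henergy T₀ ⟨hT.le, le_rfl⟩ x hx0 hx
  refine ⟨isWellPosed_of_isIntegralCurveOn hd0 hε.ne' hT.le hw hx hx0, x,
    (isBandLimitedSolution_of_isIntegralCurveOn hd0 hε.ne' hT.le hw hx hx0).1, hx0,
    fun t ht => (hband t ht).symm, hx, ?_, ?_, ?_, ?_⟩
  · rcases hcTA with h | h
    · rw [h]; linarith
    · rw [h]; linarith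
  · intro t ht i
    rw [← stateCutoff_equilibrium]
    exact memH_cutoff m ε _
  · refine ContinuousOn.intervalIntegrable ?_
    rw [uIcc_of_le hT.le]
    have hxc := IsIntegralCurveOn.continuousOn_Icc hx
    exact ((continuous_stateNormSq_stateCutoff ε m w).comp_continuousOn
      (((lipschitzOnBalls_equilibrium ε v w cs hd0).continuous.comp_continuousOn hxc).sub hxc)).congr
        hdiss
  · have hsup : (⨆ t : Set.Icc (0 : ℝ) T₀, stateNormSq m w (x t)) ≤ 3 / 2 * A := by
      have : Nonempty (Set.Icc (0 : ℝ) T₀) := ⟨⟨0, le_rfl, hT.le⟩⟩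
      refine ciSup_le fun t => ?_
      have h1 := hE t t.2
      have h2 := hpos x t t.2.1
      rw [hband t t.2] at h1
      linarith
    have hint : ∫ s in (0 : ℝ)..T₀, stateNormSq m w (equilibrium ε v w cs (x s) - x s)
        = ∫ s in (0 : ℝ)..T₀, stateNormSq m w (stateCutoff ε (equilibrium ε v w cs (x s) - x s)) := by
      refine intervalIntegral.integral_congr fun s hs => ?_
      rw [uIcc_of_le hT.le] at hs
      exact hdiss s hs
    have hdissle : (1 / ε ^ 2) * ∫ s in (0 : ℝ)..T₀,
        stateNormSq m w (equilibrium ε v w cs (x s) - x s) ≤ ν * (3 / 2 * A) := by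
      have h1 := hE T₀ ⟨hT.le, le_rfl⟩
      have h2 : 0 ≤ stateNormSq m w (stateCutoff ε (x T₀)) := stateNormSq_nonneg hw m _
      rw [hint]
      calc _ = ν * (1 / (ε ^ 2 * ν) * ∫ s in (0 : ℝ)..T₀,
            stateNormSq m w (stateCutoff ε (equilibrium ε v w cs (x s) - x s))) := by
            field_simp
        _ ≤ _ := mul_le_mul_of_nonneg_left (by linarith) hν.le
    refine (add_le_add hsup hdissle).trans ?_
    rcases hcTA with h | h
    · rw [h]
      have e : (ν + ν ^ 2) * A / (ν - 2 / 3 * ν) - ν * A = (3 + 2 * ν) * A := by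
        have : ν - 2 / 3 * ν ≠ 0 := by
          have : ν - 2 / 3 * ν = ν / 3 := by ring
          rw [this]
          positivity
        field_simp
        ring
      rw [e]
      nlinarith [mul_nonneg hν.le hA0]
    · simp [h]
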